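/- **Setting.** Let $X=\bigsqcup_{n\in\mathbb N}X_n$ be a separated disjoint union of finite metric spaces, i.e. an extended metric space whose metric restricts to the given finite-valued metric on each $X_n$ and with $d(X_n,X_m)=\infty$ for $n\neq m$. Assume that $X$ has bounded geometry ($\sup_{x}\#B(x,R)<\infty$ for every $R>0$) and is monogenic; fix a symmetric entourage $E_0\subseteq X\times X$ generating the coarse structure, i.e. $d$ is bounded on $E_0$ and every $F\subseteq X\times X$ on which $d$ is bounded lies in some $n$-fold composition $E_0\circ\cdots\circ E_0$. Let $\mathbb C_u[X]$ be the algebra of complex $X\times X$ matrices with uniformly bounded entries and finite propagation ($\sup\{d(x,y): T_{xy}\ne 0\}<\infty$). A *partial translation* is a $V\in\mathbb C_u[X]$ with entries in $\{0,1\}$ and at most one nonzero entry in each row and each column. Put $\Phi(T)(x)=\sum_yT_{xy}$, so $\Phi(T)\in\ell^\infty(X)$, and view $\ell^\infty(X)\subseteq\mathbb C_u[X]$ as diagonal matrices. Let $\|T\|_{\ell^1}=\inf\{\sum_{i=1}^N\|f_i\|_\infty : T=\sum_{i=1}^N f_iV_i\}$, over $f_i\in\ell^\infty(X)$ and partial translations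 $V_i$. A *representation* on a complex Banach space $B$ is a unital algebra homomorphism $\pi:\mathbb C_u[X]\to\mathcal L(B)$ with $\|\pi(T)\|\le\|T\|_{\ell^1}$ for all $T$. Let $$B^\pi=\{\xi\in B:\ \pi(V)\xi=\pi(\Phi(V))\xi\ \text{ for every partial translation } V\},$$ and let $B_\pi\subseteq B$ be the annihilator of the functionals invariant under the dual representation, i.e. of those $f\in B^*$ with $f\circ\pi(V^*)=f\circ\pi(\Phi(V))$ for every partial translation $V$, where $V^*$ is the conjugate transpose. Let $\mathfrak B$ be a family of complex Banach spaces which is *uniformly convex*, i.e. for every $\varepsilon>0$ there is $\delta>0$ such that $1-\tfrac12\|\xi+\eta\|\ge\delta$ for all $B\in\mathfrak B$ and all unit vectors $\xi,\eta\in B$ with $\|\xi-\eta\|\ge\varepsilon$; and *closed under ultraproducts*, i.e. for all $B_1,B_2,\dots\in\mathfrak B$ and every non-principal ultrafilter $\omega$ on $\mathbb N$, the quotient of the space of bounded sequences in $\prod_nB_n$ by the subspace of those with $\lim_{n\to\omega}\|\xi_n\|=0$ belongs to $\mathfrak B$ (up to isometric isomorphism). $X$ has *uniform geometric property $(T_{\mathfrak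 B})$* if there is $c>0$ such that for every $B\in\mathfrak B$, every representation $\pi$ on $B$ and every unit vector $[\xi]\in B/B^\pi$ there is a partial translation $V$ with support in $E_0$ and $\big\|[\pi(V)\xi-\pi(\Phi(V))\xi]\big\|_{B/B^\pi}\ge c$. Let $C_{\mathfrak B,\max}(X)$ be the completion of $\mathbb C_u[X]$ for $\|a\|_{\mathfrak B,\max}=\sup\{\|\pi(a)\| : \pi \text{ a representation on some } B\in\mathfrak B\}$. For a representation $\pi$ on a space in $\mathfrak B$, let $Q_\pi$ be its continuous extension to $C_{\mathfrak B,\max}(X)$, with values in the closure of $\pi(\mathbb C_u[X])$ in $\mathcal L(B)$, and let $p_\pi\in\mathcal L(B)$ be the idempotent with range $B^\pi$ and kernel $B_\pi$. **Theorem.** The following are equivalent: 1. $X$ has uniform geometric property $(T_{\mathfrak B})$; 2. there is an idempotent $p\in C_{\mathfrak B,\max}(X)$ such that $Q_\pi(p)=p_\pi$ for every representation $\pi:\mathbb C_u[X]\to\mathcal L(B)$ with $B\in\mathfrak B$. -/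

import Mathlib

open scoped NNReal ENNReal Topology
open Filter

universe u v

noncomputable section

namespace GeomBanachT

/-! ### Coarse geometry of extended metric spaces -/

/-- Bounded geometry: for every `R`, the balls of radius `R` have uniformly bounded cardinality. -/
class BoundedGeometry (X : Type u) [EMetricSpace X] : Prop where
  exists_bound : ∀ R : ℝ≥0, ∃ N : ℕ, ∀ x : X, {y : X | edist x y ≤ R}.encard ≤ N

/-- `X` is the separated disjoint union of a sequence of finite metric spaces: the fibres of `ι` are
the pieces, all distances inside a piece are finite, all distances between distinct pieces are `∞`. -/
def IsSeparatedUnionOfFinite (X : Type u) [EMetricSpace X] : Prop :=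
  ∃ ι : X → ℕ, (∀ n, (ι ⁻¹' {n}).Finite) ∧ ∀ x y : X, edist x y < ⊤ ↔ ι x = ι y

/-- `E` is an entourage (a controlled set): it is contained in some `R`-diagonal. -/
def IsEntourage {X : Type u} [EMetricSpace X] (E : Set (X × X)) : Prop :=
  ∃ R : ℝ≥0, ∀ p ∈ E, edist p.1 p.2 ≤ R

/-- Composition of entourages. -/
def relComp {X : Type u} (E F : Set (X × X)) : Set (X × X) :=
  {p | ∃ z, (p.1, z) ∈ E ∧ (z, p.2) ∈ F}

/-- `relPow E n` is the composition of `n + 1` copies of `E`. -/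
def relPow {X : Type u} (E : Set (X × X)) : ℕ → Set (X × X)
  | 0 => E
  | n + 1 => relComp (relPow E n) E

/-- `E` is a symmetric entourage which generates the coarse structure of `X`; the space `X` is
monogenic when such an `E` exists. -/
structure IsSymmGenerating {X : Type u} [EMetricSpace X] (E : Set (X × X)) : Prop where
  isEntourage : IsEntourage E
  symm : ∀ x y : X, (x, y) ∈ E → (y, x) ∈ E
  generates : ∀ F : Set (X × X), IsEntourage F → ∃ n : ℕ, F ⊆ relPow E n

/-! ### The algebraic uniform Roe algebra -/

/-- The complex `X × X` matrices with bounded entries and finite propagation. -/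
def roeSubmodule (X : Type u) [EMetricSpace X] : Submodule ℂ (X → X → ℂ) where
  carrier := {T | (∃ M : ℝ, ∀ x y, ‖T x y‖ ≤ M) ∧
    ∃ R : ℝ≥0, ∀ x y, T x y ≠ 0 → edist x y ≤ R}
  zero_mem' := ⟨⟨0, by simp⟩, ⟨0, by simp⟩⟩
  add_mem' := by
    rintro T S ⟨⟨M, hM⟩, R, hR⟩ ⟨⟨M', hM'⟩, R', hR'⟩
    refine ⟨⟨M + M', fun x y => (norm_add_le _ _).trans (add_le_add (hM x y) (hM' x y))⟩,
      max R R', fun x y h => ?_⟩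
    by_cases hT : T x y = 0
    · have hS : S x y ≠ 0 := fun hS => h (by simp [hT, hS])
      exact (hR' x y hS).trans (by exact_mod_cast le_max_right R R')
    · exact (hR x y hT).trans (by exact_mod_cast le_max_left R R')
  smul_mem' := by
    rintro c T ⟨⟨M, hM⟩, R, hR⟩
    refine ⟨⟨‖c‖ * M, fun x y => ?_⟩, R, fun x y h => hR x y fun h0 => h (by simp [h0])⟩
    simpa using mul_le_mul_of_nonneg_left (hM x y) (norm_nonneg c)

/-- The algebraic uniform Roe algebra `ℂ_u[X]`. -/
def Roe (X : Type u) [EMetricSpace X] : Type u := ↥(roeSubmodule X)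

namespace Roe

variable {X : Type u} [EMetricSpace X]

instance : AddCommGroup (Roe X) := inferInstanceAs (AddCommGroup ↥(roeSubmodule X))
instance : Module ℂ (Roe X) := inferInstanceAs (Module ℂ ↥(roeSubmodule X))

/-- The matrix entry `T x y`. -/
def entry (T : Roe X) (x y : X) : ℂ := T.1 x y

/-- An element of `ℂ_u[X]` from a matrix with bounded entries and finite propagation. -/
def ofMatrix (T : X → X → ℂ) (hb : ∃ M : ℝ, ∀ x y, ‖T x y‖ ≤ M)
    (hp : ∃ R : ℝ≥0, ∀ x y, T x y ≠ 0 → edist x y ≤ R) : Roe X := ⟨T, hb, hp⟩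

@[simp] lemma entry_ofMatrix (T : X → X → ℂ) (hb hp) (x y : X) :
    (ofMatrix T hb hp).entry x y = T x y := rfl

@[ext] lemma ext {T S : Roe X} (h : ∀ x y, T.entry x y = S.entry x y) : T = S :=
  Subtype.ext (funext fun x => funext fun y => h x y)

lemma entry_bounded (T : Roe X) : ∃ M : ℝ, ∀ x y, ‖T.entry x y‖ ≤ M := T.2.1

lemma finite_propagation (T : Roe X) :
    ∃ R : ℝ≥0, ∀ x y, T.entry x y ≠ 0 → edist x y ≤ R := T.2.2

@[simp] lemma entry_zero (x y : X) : (0 : Roe X).entry x y = 0 := rfl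
@[simp] lemma entry_add (T S : Roe X) (x y : X) :
    (T + S).entry x y = T.entry x y + S.entry x y := rfl
@[simp] lemma entry_smul (c : ℂ) (T : Roe X) (x y : X) :
    (c • T).entry x y = c * T.entry x y := rfl

lemma exists_row_finset [BoundedGeometry X] (T : Roe X) :
    ∃ N : ℕ, ∀ x, ∃ F : Finset X, F.card ≤ N ∧ ∀ z, T.entry x z ≠ 0 → z ∈ F := by
  obtain ⟨R, hR⟩ := T.finite_propagation
  obtain ⟨N, hN⟩ := BoundedGeometry.exists_bound (X := X) R
  refine ⟨N, fun x => ?_⟩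
  have hfin : {y : X | edist x y ≤ R}.Finite :=
    Set.finite_of_encard_le_coe (hN x)
  refine ⟨hfin.toFinset, ?_, fun z hz => by simpa using hR x z hz⟩
  have := hN x
  rw [hfin.encard_eq_coe_toFinset_card] at this
  exact_mod_cast this

lemma finsum_row_eq (T : Roe X) (x : X) (F : Finset X) (hF : ∀ z, T.entry x z ≠ 0 → z ∈ F)
    (g : X → ℂ) : ∑ᶠ z, T.entry x z * g z = ∑ z ∈ F, T.entry x z * g z :=
  finsum_eq_sum_of_support_subset _ fun z hz => by
    have h : T.entry x z * g z ≠ 0 := hz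
    exact hF z (left_ne_zero_of_mul h)

/-- The identity matrix. -/
instance : One (Roe X) where
  one := by
    classical
    exact ofMatrix (fun x y => if x = y then 1 else 0)
      ⟨1, fun x y => by split_ifs <;> simp⟩
      ⟨0, fun x y h => by
        have hxy : x = y := by by_contra h'; simp [h'] at h
        simp [hxy]⟩

open Classical in
lemma entry_one (x y : X) : (1 : Roe X).entry x y = if x = y then 1 else 0 := by
  show (if x = y then (1 : ℂ) else 0) = _
  congr

/-- Matrix multiplication; the sum is finite by bounded geometry. -/
instance [BoundedGeometry X] : Mul (Roe X) where
  mul T S := ofMatrix (fun x y => ∑ᶠ z, T.entry x z * S.entry z y)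
    (by
      obtain ⟨N, hN⟩ := T.exists_row_finset
      obtain ⟨M, hM⟩ := T.entry_bounded
      obtain ⟨M', hM'⟩ := S.entry_bounded
      refine ⟨N * (|M| * |M'|), fun x y => ?_⟩
      obtain ⟨F, hF, hz⟩ := hN x
      rw [T.finsum_row_eq x F hz]
      calc ‖∑ z ∈ F, T.entry x z * S.entry z y‖
          ≤ ∑ z ∈ F, ‖T.entry x z * S.entry z y‖ := norm_sum_le _ _
        _ ≤ ∑ _z ∈ F, |M| * |M'| := Finset.sum_le_sum fun z _ => by
            rw [norm_mul]
            exact mul_le_mul ((hM x z).trans (le_abs_self M)) ((hM' z y).trans (le_abs_self M'))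
              (norm_nonneg _) (abs_nonneg _)
        _ = F.card * (|M| * |M'|) := by simp
        _ ≤ N * (|M| * |M'|) := by gcongr)
    (by
      obtain ⟨R, hR⟩ := T.finite_propagation
      obtain ⟨R', hR'⟩ := S.finite_propagation
      refine ⟨R + R', fun x y h => ?_⟩
      obtain ⟨z, hz⟩ : ∃ z, T.entry x z * S.entry z y ≠ 0 := by
        by_contra hcon
        push Not at hcon
        exact h (by simp [hcon])
      push_cast
      exact (edist_triangle x z y).trans
        (add_le_add (hR x z (left_ne_zero_of_mul hz)) (hR' z y (right_ne_zero_of_mul hz))))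

variable [BoundedGeometry X]

lemma entry_mul (T S : Roe X) (x y : X) :
    (T * S).entry x y = ∑ᶠ z, T.entry x z * S.entry z y := rfl

lemma entry_mul_eq_sum (T S : Roe X) (x y : X) (F : Finset X)
    (hF : ∀ z, T.entry x z ≠ 0 → z ∈ F) :
    (T * S).entry x y = ∑ z ∈ F, T.entry x z * S.entry z y :=
  T.finsum_row_eq x F hF _

instance : Ring (Roe X) where
  __ := (inferInstance : AddCommGroup (Roe X))
  left_distrib T S R := by
    ext x y
    obtain ⟨_, h⟩ := T.exists_row_finset
    obtain ⟨F, -, hF⟩ := h x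
    simp only [entry_add, entry_mul_eq_sum T _ x y F hF, mul_add, Finset.sum_add_distrib]
  right_distrib T S R := by
    classical
    ext x y
    obtain ⟨_, h⟩ := T.exists_row_finset
    obtain ⟨F, -, hF⟩ := h x
    obtain ⟨_, h'⟩ := S.exists_row_finset
    obtain ⟨G, -, hG⟩ := h' x
    have hT : ∀ z, T.entry x z ≠ 0 → z ∈ F ∪ G := fun z hz => Finset.mem_union_left _ (hF z hz)
    have hS : ∀ z, S.entry x z ≠ 0 → z ∈ F ∪ G := fun z hz => Finset.mem_union_right _ (hG z hz)
    have hTS : ∀ z, (T + S).entry x z ≠ 0 → z ∈ F ∪ G := fun z hz => by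
      by_cases h0 : T.entry x z = 0
      · exact hS z fun h1 => hz (by simp [h0, h1])
      · exact hT z h0
    simp only [entry_add, entry_mul_eq_sum _ _ x y _ hT, entry_mul_eq_sum _ _ x y _ hS,
      entry_mul_eq_sum _ _ x y _ hTS, add_mul, Finset.sum_add_distrib]
  zero_mul T := by ext x y; simp [entry_mul]
  mul_zero T := by ext x y; simp [entry_mul]
  mul_assoc T S R := by
    classical
    ext x y
    obtain ⟨_, h⟩ := T.exists_row_finset
    obtain ⟨F, -, hF⟩ := h x
    obtain ⟨_, h'⟩ := S.exists_row_finset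
    choose G _ hG using h'
    have hS : ∀ z ∈ F, ∀ w, S.entry z w ≠ 0 → w ∈ F.biUnion G := fun z hz w hw =>
      Finset.mem_biUnion.2 ⟨z, hz, hG z w hw⟩
    have hTS : ∀ w, (T * S).entry x w ≠ 0 → w ∈ F.biUnion G := fun w hw => by
      rw [entry_mul_eq_sum T S x w F hF] at hw
      obtain ⟨z, hz, hz0⟩ := Finset.exists_ne_zero_of_sum_ne_zero hw
      exact hS z hz w (right_ne_zero_of_mul hz0)
    rw [entry_mul_eq_sum _ R x y _ hTS, entry_mul_eq_sum T _ x y F hF]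
    simp only [entry_mul_eq_sum T S x _ F hF, Finset.sum_mul]
    rw [Finset.sum_comm]
    refine Finset.sum_congr rfl fun z hz => ?_
    rw [entry_mul_eq_sum S R z y _ (hS z hz), Finset.mul_sum]
    exact Finset.sum_congr rfl fun w _ => by ring
  one_mul T := by
    classical
    ext x y
    have h1 : ∀ z, (1 : Roe X).entry x z ≠ 0 → z ∈ ({x} : Finset X) := fun z hz => by
      by_contra h
      exact hz (by rw [entry_one, if_neg]; rintro rfl; simp at h)
    rw [entry_mul_eq_sum 1 T x y _ h1]
    simp [entry_one]
  mul_one T := by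
    classical
    ext x y
    obtain ⟨_, h⟩ := T.exists_row_finset
    obtain ⟨F, -, hF⟩ := h x
    rw [entry_mul_eq_sum T 1 x y F hF]
    simp only [entry_one, mul_ite, mul_one, mul_zero, Finset.sum_ite_eq']
    by_cases hy : y ∈ F
    · simp [hy]
    · rw [if_neg hy]
      by_contra h0
      exact hy (hF y fun h1 => h0 h1.symm)

instance : Algebra ℂ (Roe X) := Algebra.ofModule
  (fun c T S => by
    ext x y
    obtain ⟨_, h⟩ := T.exists_row_finset
    obtain ⟨F, -, hF⟩ := h x
    have hc : ∀ z, (c • T).entry x z ≠ 0 → z ∈ F := fun z hz => hF z (right_ne_zero_of_mul hz)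
    rw [entry_smul, entry_mul_eq_sum _ S x y F hc, entry_mul_eq_sum T S x y F hF, Finset.mul_sum]
    exact Finset.sum_congr rfl fun z _ => by rw [entry_smul, mul_assoc])
  (fun c T S => by
    ext x y
    obtain ⟨_, h⟩ := T.exists_row_finset
    obtain ⟨F, -, hF⟩ := h x
    rw [entry_smul, entry_mul_eq_sum T _ x y F hF, entry_mul_eq_sum T S x y F hF, Finset.mul_sum]
    exact Finset.sum_congr rfl fun z _ => by rw [entry_smul]; ring)

end Roe

/-- `ℓ^∞(X)`. -/
abbrev EllInfty (X : Type u) : Type u := lp (fun _ : X => ℂ) ∞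

namespace Roe

variable {X : Type u} [EMetricSpace X]

/-- The diagonal operator of a bounded function. -/
def diag (f : EllInfty X) : Roe X := by
  classical
  exact ofMatrix (fun x y => if x = y then f x else 0)
    ⟨‖f‖, fun x y => by
      split_ifs
      · exact lp.norm_apply_le_norm ENNReal.top_ne_zero f x
      · simp⟩
    ⟨0, fun x y h => by
      have hxy : x = y := by by_contra h'; simp [h'] at h
      simp [hxy]⟩

open Classical in
lemma entry_diag (f : EllInfty X) (x y : X) :
    (diag f).entry x y = if x = y then f x else 0 := by
  show (if x = y then f x else 0) = _
  congr

/-- The map `Φ : ℂ_u[X] → ℓ^∞(X)`, `Φ(T)(x) = ∑ y, T x y`. -/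
def rowSum [BoundedGeometry X] (T : Roe X) : EllInfty X :=
  ⟨fun x => ∑ᶠ y, T.entry x y, memℓp_infty (by
    obtain ⟨N, hN⟩ := T.exists_row_finset
    obtain ⟨M, hM⟩ := T.entry_bounded
    refine ⟨N * |M|, ?_⟩
    rintro _ ⟨x, rfl⟩
    obtain ⟨F, hF, hz⟩ := hN x
    have h1 : ∑ᶠ y, T.entry x y = ∑ y ∈ F, T.entry x y := by
      simpa using T.finsum_row_eq x F hz (fun _ => 1)
    show ‖∑ᶠ y, T.entry x y‖ ≤ N * |M|
    rw [h1]
    calc ‖∑ y ∈ F, T.entry x y‖ ≤ ∑ y ∈ F, ‖T.entry x y‖ := norm_sum_le _ _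
      _ ≤ ∑ _y ∈ F, |M| := Finset.sum_le_sum fun y _ => (hM x y).trans (le_abs_self M)
      _ = F.card * |M| := by simp
      _ ≤ N * |M| := by gcongr)⟩

/-- The conjugate transpose. -/
def adj (T : Roe X) : Roe X :=
  ofMatrix (fun x y => star (T.entry y x))
    (by
      obtain ⟨M, hM⟩ := T.entry_bounded
      exact ⟨M, fun x y => by simpa using hM y x⟩)
    (by
      obtain ⟨R, hR⟩ := T.finite_propagation
      exact ⟨R, fun x y h => by
        rw [edist_comm]
        exact hR y x fun h0 => h (by simp [h0])⟩)

/-- The support of a matrix. -/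
def supp (T : Roe X) : Set (X × X) := {p | T.entry p.1 p.2 ≠ 0}

/-- Partial translations: the `0`-`1` matrices in `ℂ_u[X]` having at most one nonzero entry in every
row and in every column, i.e. the matrices of local bijections of `X`. -/
structure IsPartialTranslation (V : Roe X) : Prop where
  zero_or_one : ∀ x y, V.entry x y = 0 ∨ V.entry x y = 1
  row : ∀ x y y', V.entry x y ≠ 0 → V.entry x y' ≠ 0 → y = y'
  col : ∀ x x' y, V.entry x y ≠ 0 → V.entry x' y ≠ 0 → x = x'

/-- The `ℓ¹`-norm on `ℂ_u[X]`: the infimum of `∑ ‖f i‖` over all `T = ∑ f i • V i` with `f i` a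
bounded function and `V i` a partial translation. -/
def ellOneNorm [BoundedGeometry X] (T : Roe X) : ℝ :=
  sInf {s | ∃ (n : ℕ) (f : Fin n → EllInfty X) (V : Fin n → Roe X),
    (∀ i, (V i).IsPartialTranslation) ∧ T = ∑ i, diag (f i) * V i ∧ s = ∑ i, ‖f i‖}

end Roe

/-! ### Representations -/

/-- A complex Banach space. -/
structure BanachSp : Type (v + 1) where
  /-- The underlying type. -/
  carrier : Type v
  [normedAddCommGroup : NormedAddCommGroup carrier]
  [normedSpace : NormedSpace ℂ carrier]
  [completeSpace : CompleteSpace carrier]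

attribute [instance] BanachSp.normedAddCommGroup BanachSp.normedSpace BanachSp.completeSpace

instance : CoeSort BanachSp.{v} (Type v) := ⟨BanachSp.carrier⟩

/-- A representation of `ℂ_u[X]` on `B`: a unital homomorphism `ℂ_u[X] → L(B)` which is
contractive with respect to the `ℓ¹`-norm. -/
structure RoeRep (X : Type u) [EMetricSpace X] [BoundedGeometry X] (B : Type v)
    [NormedAddCommGroup B] [NormedSpace ℂ B] where
  /-- The underlying unital algebra homomorphism. -/
  toAlgHom : Roe X →ₐ[ℂ] (B →L[ℂ] B)
  contractive : ∀ T : Roe X, ‖toAlgHom T‖ ≤ T.ellOneNorm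

namespace RoeRep

variable {X : Type u} [EMetricSpace X] [BoundedGeometry X] {B : Type v}
  [NormedAddCommGroup B] [NormedSpace ℂ B]

/-- The subspace `B^π` of invariant vectors: `π(V) ξ = π(Φ(V)) ξ` for every partial translation. -/
def invariants (π : RoeRep X B) : Submodule ℂ B where
  carrier := {ξ | ∀ V : Roe X, V.IsPartialTranslation →
    π.toAlgHom V ξ = π.toAlgHom (Roe.diag V.rowSum) ξ}
  zero_mem' := fun V _ => by simp
  add_mem' := fun ha hb V hV => by simp [ha V hV, hb V hV]
  smul_mem' := fun c a ha V hV => by simp [ha V hV]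

/-- The dual action of `ℂ_u[X]` on the dual space: `(π*(T) f)(ξ) = f (π(T*) ξ)`. -/
def dualAct (π : RoeRep X B) (T : Roe X) (f : StrongDual ℂ B) : StrongDual ℂ B :=
  f.comp (π.toAlgHom T.adj)

/-- The invariant functionals `(B*)^{π*}`. -/
def dualInvariants (π : RoeRep X B) : Set (StrongDual ℂ B) :=
  {f | ∀ V : Roe X, V.IsPartialTranslation →
    π.dualAct V f = π.dualAct (Roe.diag V.rowSum) f}

/-- The subspace `B_π`: the annihilator in `B` of the invariant functionals. -/
def annihilator (π : RoeRep X B) : Submodule ℂ B where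
  carrier := {ξ | ∀ f ∈ π.dualInvariants, f ξ = 0}
  zero_mem' := fun f _ => by simp
  add_mem' := fun ha hb f hf => by simp [ha f hf, hb f hf]
  smul_mem' := fun c a ha f hf => by simp [ha f hf]

/-- For every unit vector `[ξ]` of `B ⧸ B^π` there is a partial translation `V` supported in `E₀`
that moves `[ξ]` by at least `c`. The operator `π(V) - π(Φ(V))` vanishes on `B^π`, so that
`[π(V) ξ - π(Φ(V)) ξ]` depends only on `[ξ]`. -/
def HasSpectralGap (π : RoeRep X B) (E₀ : Set (X × X)) (c : ℝ) : Prop :=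
  ∀ ξ : B, ‖(Submodule.Quotient.mk ξ : B ⧸ π.invariants)‖ = 1 →
    ∃ V : Roe X, V.IsPartialTranslation ∧ V.supp ⊆ E₀ ∧
      c ≤ ‖(Submodule.Quotient.mk
        (π.toAlgHom V ξ - π.toAlgHom (Roe.diag V.rowSum) ξ) : B ⧸ π.invariants)‖

end RoeRep

/-- `X` has uniform geometric property `(T_𝔅)` (with respect to the generating entourage `E₀`): all
representations on members of `𝔅` have a common spectral gap. -/
def UniformGeometricT {X : Type u} [EMetricSpace X] [BoundedGeometry X] (E₀ : Set (X × X))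
    (𝔅 : Set BanachSp.{v}) : Prop :=
  ∃ c : ℝ, 0 < c ∧ ∀ B ∈ 𝔅, ∀ π : RoeRep X B, π.HasSpectralGap E₀ c

/-! ### Families of Banach spaces -/

/-- `𝔅` is uniformly convex: for every `ε > 0` the infimum over `B ∈ 𝔅` of the moduli of convexity
`inf {1 - ‖ξ + η‖ / 2 | ‖ξ‖ = ‖η‖ = 1, ‖ξ - η‖ ≥ ε}` is positive. -/
def UniformlyConvexFamily (𝔅 : Set BanachSp.{v}) : Prop :=
  ∀ ε : ℝ, 0 < ε → ∃ δ : ℝ, 0 < δ ∧ ∀ B ∈ 𝔅, ∀ ξ η : B, ‖ξ‖ = 1 → ‖η‖ = 1 → ε ≤ ‖ξ - η‖ →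
    δ ≤ 1 - ‖ξ + η‖ / 2

/-- The bounded sequences `(ξ n)` in `∏ B n` with `lim_{n → ω} ‖ξ n‖ = 0`. -/
def ultraNull (B : ℕ → BanachSp.{v}) (ω : Ultrafilter ℕ) :
    Submodule ℂ (lp (fun n => (B n : Type v)) ∞) where
  carrier := {ξ | Tendsto (fun n => ‖ξ n‖) ω (𝓝 0)}
  zero_mem' := by simp
  add_mem' := by
    intro a b ha hb
    have h : Tendsto (fun n => ‖a n‖ + ‖b n‖) ω (𝓝 0) := by simpa using Tendsto.add ha hb
    exact squeeze_zero (fun n => norm_nonneg _) (fun n => norm_add_le (a n) (b n)) h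
  smul_mem' := by
    intro c a ha
    have h : Tendsto (fun n => ‖c‖ * ‖a n‖) ω (𝓝 0) := by simpa using Tendsto.const_mul ‖c‖ ha
    exact squeeze_zero (fun n => norm_nonneg _) (fun n => norm_smul_le c (a n)) h

/-- The Banach space ultraproduct of `(B n)` along `ω`: the bounded sequences modulo the null
sequences, with the quotient norm. -/
abbrev Ultraproduct (B : ℕ → BanachSp.{v}) (ω : Ultrafilter ℕ) : Type v :=
  lp (fun n => (B n : Type v)) ∞ ⧸ ultraNull B ω

/-- `𝔅` is closed under ultraproducts along nonprincipal ultrafilters on `ℕ` (membership in `𝔅` is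
understood up to isometric isomorphism). -/
def ClosedUnderUltraproducts (𝔅 : Set BanachSp.{v}) : Prop :=
  ∀ B : ℕ → BanachSp.{v}, (∀ n, B n ∈ 𝔅) → ∀ ω : Ultrafilter ℕ, (∀ n, ω ≠ pure n) →
    ∃ B' ∈ 𝔅, Nonempty (B' ≃ₗᵢ[ℂ] Ultraproduct B ω)

/-! ### The maximal Roe algebra of a family of Banach spaces -/

section MaxRoe

variable (X : Type u) [EMetricSpace X] [BoundedGeometry X] (𝔅 : Set BanachSp.{v})

/-- All representations of `ℂ_u[X]` on members of `𝔅`. -/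
abbrev RepsOn : Type (max u (v + 1)) := Σ B : 𝔅, RoeRep X (B : BanachSp.{v})

variable {X}

lemma bddAbove_reps (T : Roe X) : BddAbove (Set.range fun i : RepsOn X 𝔅 => ‖i.2.toAlgHom T‖) :=
  ⟨T.ellOneNorm, by rintro _ ⟨i, rfl⟩; exact i.2.contractive T⟩

variable (X)

/-- The (semi)norm `‖T‖ = sup ‖π(T)‖` over all representations `π` on members of `𝔅`. -/
def maxSeminorm : RingSeminorm (Roe X) where
  toFun T := ⨆ i : RepsOn X 𝔅, ‖i.2.toAlgHom T‖
  map_zero' := by simp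
  add_le' T S := Real.iSup_le (fun i => by
      rw [map_add]
      exact (norm_add_le _ _).trans
        (add_le_add (le_ciSup (bddAbove_reps 𝔅 T) i) (le_ciSup (bddAbove_reps 𝔅 S) i)))
    (add_nonneg (Real.iSup_nonneg fun _ => norm_nonneg _)
      (Real.iSup_nonneg fun _ => norm_nonneg _))
  neg' T := by simp
  mul_le' T S := Real.iSup_le (fun i => by
      rw [map_mul]
      exact (norm_mul_le _ _).trans
        (mul_le_mul (le_ciSup (bddAbove_reps 𝔅 T) i) (le_ciSup (bddAbove_reps 𝔅 S) i)
          (norm_nonneg _) (Real.iSup_nonneg fun _ => norm_nonneg _)))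
    (mul_nonneg (Real.iSup_nonneg fun _ => norm_nonneg _)
      (Real.iSup_nonneg fun _ => norm_nonneg _))

/-- A copy of `ℂ_u[X]`, endowed with the norm `maxSeminorm X 𝔅`. -/
@[nolint unusedArguments]
def NormedRoe (_𝔅 : Set BanachSp.{v}) : Type u := Roe X

instance : SeminormedRing (NormedRoe X 𝔅) :=
  RingSeminorm.toSeminormedRing (R := Roe X) (maxSeminorm X 𝔅)

/-- The maximal `𝔅`-Roe algebra `C_{𝔅,max}(X)`: the (Hausdorff) completion of `ℂ_u[X]`. -/
abbrev MaxRoe : Type u := UniformSpace.Completion (NormedRoe X 𝔅)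

variable {X 𝔅}

/-- A representation on a member of `𝔅` as a ring homomorphism on the normed copy of `ℂ_u[X]`. -/
def RoeRep.toNormedHom {B : BanachSp.{v}} (π : RoeRep X B) (𝔅 : Set BanachSp.{v}) :
    NormedRoe X 𝔅 →+* (B →L[ℂ] B) :=
  RingHomClass.toRingHom (π.toAlgHom)

lemma RoeRep.norm_toNormedHom_le {B : BanachSp.{v}} (hB : B ∈ 𝔅) (π : RoeRep X B) (T : NormedRoe X 𝔅) :
    ‖π.toNormedHom 𝔅 T‖ ≤ ‖T‖ :=
  le_ciSup (f := fun i : RepsOn X 𝔅 => ‖i.2.toAlgHom T‖) (bddAbove_reps 𝔅 T) ⟨⟨B, hB⟩, π⟩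

lemma RoeRep.continuous_toNormedHom {B : BanachSp.{v}} (hB : B ∈ 𝔅) (π : RoeRep X B) :
    Continuous (π.toNormedHom 𝔅) :=
  AddMonoidHomClass.continuous_of_bound (π.toNormedHom 𝔅) 1 fun T => by
    simpa using π.norm_toNormedHom_le hB T

/-- The canonical homomorphism `Q_π` from `C_{𝔅,max}(X)` to `C_π(X)`, the closure of the image of `π`
in `L(B)`: the continuous extension of `π`, with values in `L(B)`. -/
def RoeRep.extend {B : BanachSp.{v}} (hB : B ∈ 𝔅) (π : RoeRep X B) : MaxRoe X 𝔅 →+* (B →L[ℂ] B) :=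
  UniformSpace.Completion.extensionHom (π.toNormedHom 𝔅) (π.continuous_toNormedHom hB)

end MaxRoe

/-- `P` is the idempotent onto the subspace `M` along the subspace `N`. -/
structure IsIdempotentOntoAlong {B : Type v} [NormedAddCommGroup B] [NormedSpace ℂ B]
    (P : B →L[ℂ] B) (M N : Submodule ℂ B) : Prop where
  idem : P * P = P
  range_eq : LinearMap.range (P : B →ₗ[ℂ] B) = M
  ker_eq : LinearMap.ker (P : B →ₗ[ℂ] B) = N

end GeomBanachT

end

open GeomBanachT

noncomputable section

namespace GeomBanachT

/-! ### Harmonic functionals on uniformly convex spaces -/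

section Harmonic

/-! By bounded geometry `E₀` is covered by the graphs of finitely many involutions ("flips",
`exists_flips`). Their permutation matrices act in every representation as isometries of order two.
They generate `ℂ_u[X]` over the diagonal matrices (`induction_flips`), so invariance of a vector or
of a functional may be tested on these flips alone.

From the gap to the idempotent: let `A` be the lazy Markov element, the mean of `(1 + σ)/2` over the
flips `σ`. A vector nearly of minimal norm in its class modulo `B^π` is moved substantially by some
flip, and uniform convexity makes the corresponding midpoint shorter. Hence `A` contracts the
quotient norm by a factor `l < 1` common to all representations (`exists_markov_contraction`). As `A
- 1` kills `B^π`, consecutive powers of `A` differ by at most `2 * l ^ n` in the maximal norm, so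
they converge to some `p`.

The image `P` of `p` clearly has range `B^π`, and `ker P` lies in `B_π`. The inclusion of `B_π` in
`ker P` needs `f ∘ P` to be invariant for every functional `f`, while `P * A = P` only says that it
is harmonic, i.e. equal to its mean over the flips. The bridge is `invariant_of_harmonic`: a
non-invariant harmonic functional would yield random vectors in the unit ball whose second moments
fall by a fixed amount at every iteration, eventually below zero.

From the idempotent to the gap: if the gap fails along `c = 1/(n+1)`, then `1 - P` produces vectors
`η n` in the kernels of the projections, bounded above and below and asymptotically fixed by the
flips (`exists_almost_invariant`). They define a nonzero invariant vector `v` of an ultraproduct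
representation, so `p` fixes `v`. But `p` is a norm limit of elements `T` of `ℂ_u[X]`, and these act
coordinatewise: `T` is uniformly small on the `η n`, because `p` kills them, and hence small on `v`.
This is a contradiction. -/

lemma norm_add_sq_le_two_mul {E : Type*} [SeminormedAddCommGroup E] (x y : E) :
    ‖x + y‖ ^ 2 ≤ 2 * (‖x‖ ^ 2 + ‖y‖ ^ 2) := by
  have h := norm_add_le x y
  nlinarith [norm_nonneg (x + y), sq_nonneg (‖x‖ - ‖y‖), norm_nonneg x, norm_nonneg y]

/-- In a uniformly convex space, the square of the norm is uniformly convex on the unit ball. -/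
lemma exists_norm_add_sq_le (E : Type*) [NormedAddCommGroup E] [NormedSpace ℝ E]
    [UniformConvexSpace E] {ε : ℝ} (hε : 0 < ε) :
    ∃ δ, 0 < δ ∧ ∀ x y : E, ‖x‖ ≤ 1 → ‖y‖ ≤ 1 → ε ≤ ‖x - y‖ →
      ‖x + y‖ ^ 2 ≤ 2 * (‖x‖ ^ 2 + ‖y‖ ^ 2) - δ := by
  obtain ⟨δ, hδ, h⟩ := exists_forall_closed_ball_dist_add_le_two_sub E hε
  -- If the norms differ by at least `ε * δ / 8`, the gain is the term `(‖x‖ - ‖y‖) ^ 2` lost in the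
  -- triangle inequality. Otherwise uniform convexity at scale `‖x‖ ≥ ε / 2` gains `2 * δ * ‖x‖ ^
  -- 2`, which outweighs the error from replacing `‖y‖` by `‖x‖`.
  have main : ∀ x y : E, ‖x‖ ≤ 1 → ‖y‖ ≤ ‖x‖ → ε ≤ ‖x - y‖ →
      ‖x + y‖ ^ 2 ≤ 2 * (‖x‖ ^ 2 + ‖y‖ ^ 2) - min ((ε * δ / 8) ^ 2) (ε ^ 2 * δ / 4) := by
    intro x y hx hyx hxy
    have hr : ε / 2 ≤ ‖x‖ := by linarith [norm_sub_le x y]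
    have hr0 : 0 < ‖x‖ := by linarith
    have hs : ‖x + y‖ ≤ ‖x‖ * (2 - δ) := by
      have hn : ∀ z : E, ‖(‖x‖⁻¹ : ℝ) • z‖ = ‖z‖ / ‖x‖ := fun z => by
        rw [norm_smul, norm_inv, norm_norm, inv_mul_eq_div]
      have := @h ((‖x‖⁻¹ : ℝ) • x) (by rw [hn, div_self hr0.ne']) ((‖x‖⁻¹ : ℝ) • y)
        (by rw [hn]; exact (div_le_one hr0).2 hyx)
        (by rw [← smul_sub, hn, le_div_iff₀ hr0]; nlinarith)
      rw [← smul_add, hn, div_le_iff₀ hr0] at this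
      linarith
    have hδ2 : δ ≤ 2 := by
      by_contra hcon
      nlinarith [norm_nonneg (x + y)]
    have hadd := norm_add_le x y
    have hy0 := norm_nonneg y
    have hs0 := norm_nonneg (x + y)
    by_cases ht : ε * δ / 8 ≤ ‖x‖ - ‖y‖
    · have : (ε * δ / 8) ^ 2 ≤ (‖x‖ - ‖y‖) ^ 2 := pow_le_pow_left₀ (by positivity) ht 2
      have := min_le_left ((ε * δ / 8) ^ 2) (ε ^ 2 * δ / 4)
      nlinarith
    · push Not at ht
      have h1 := min_le_right ((ε * δ / 8) ^ 2) (ε ^ 2 * δ / 4)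
      have h2 : ‖x + y‖ ^ 2 ≤ (‖x‖ * (2 - δ)) ^ 2 := pow_le_pow_left₀ hs0 hs 2
      have h3 : (‖x‖ * (2 - δ)) ^ 2 ≤ ‖x‖ ^ 2 * (4 - 2 * δ) := by
        have : 0 ≤ ‖x‖ ^ 2 * (δ * (2 - δ)) := by
          have : 0 ≤ 2 - δ := by linarith
          positivity
        nlinarith
      have h4 : ‖x‖ ^ 2 - 2 * ‖x‖ * (ε * δ / 8) ≤ ‖y‖ ^ 2 := by nlinarith
      have h5 : ε * (ε * δ / 4) ≤ 2 * ‖x‖ * (ε * δ / 4) := by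
        apply mul_le_mul_of_nonneg_right (by linarith) (by positivity)
      have h6 : ε / 2 * (‖x‖ * δ) ≤ ‖x‖ * (‖x‖ * δ) :=
        mul_le_mul_of_nonneg_right hr (by positivity)
      nlinarith
  refine ⟨min ((ε * δ / 8) ^ 2) (ε ^ 2 * δ / 4), lt_min (by positivity) (by positivity),
    fun x y hx hy hxy => ?_⟩
  rcases le_total ‖y‖ ‖x‖ with hle | hle
  · exact main x y hx hle hxy
  · have := main y x hy hle (by rwa [norm_sub_rev])
    rwa [add_comm x y, add_comm (‖x‖ ^ 2)]

variable {B : Type*} [NormedAddCommGroup B] [NormedSpace ℂ B]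

/-- Iterating a harmonic functional along a random walk produces vector-valued random variables
whose second moments decrease linearly in the number of iterations. -/
lemma exists_random_vector_of_harmonic {ι : Type u} [Fintype ι] [Nonempty ι] [UniformConvexSpace B]
    (U : ι → B ≃ₗᵢ[ℂ] B) (φ : StrongDual ℂ B) (x : B) (hx : ‖x‖ ≤ 1)
    (hφ : ∀ y, ∑ i, φ (U i y) = Fintype.card ι * φ y) (s : ι) (hs : φ (U s x) ≠ φ x) :
    ∃ δ : ℝ, 0 < δ ∧ ∃ a : ℂ, ∀ r : ℕ, ∃ (Ω : Type u) (_ : Fintype Ω) (_ : Nonempty Ω)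
      (W : Ω → B ≃ₗᵢ[ℂ] B) (Z : Ω → B), (∀ ω, ‖Z ω‖ ≤ 1) ∧ ∑ ω, Z ω = 0 ∧
      (∀ y, ∑ ω, φ (W ω y) = Fintype.card Ω * φ y) ∧
      ∑ ω, φ (W ω (Z ω)) = Fintype.card Ω * a ∧
      ∑ ω, ‖Z ω‖ ^ 2 ≤ Fintype.card Ω * (1 - r * δ) := by
  classical
  set k : ℂ := ((Fintype.card ι : ℕ) : ℂ) with hk
  have hk0 : k ≠ 0 := by simp [hk]
  set a : ℂ := (φ (U s x) - φ x) / k with ha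
  have ha0 : a ≠ 0 := div_ne_zero (sub_ne_zero.2 hs) hk0
  have hφ0 : 0 < ‖φ‖ := by
    rw [norm_pos_iff]
    rintro rfl
    simp at hs
  set η : ℝ := ‖a‖ / ‖φ‖ with hη
  have hη0 : 0 < η := div_pos (norm_pos_iff.2 ha0) hφ0
  obtain ⟨δ, hδ, hconv⟩ := exists_norm_add_sq_le B (half_pos hη0)
  -- A form of convexity linear in `‖x - y‖`, so that it can be averaged: close pairs are absorbed
  -- by `δ * (η / 2)`, and for the others `‖x - y‖ ≤ 2` is compared with the gain.
  have key : ∀ x y : B, ‖x‖ ≤ 1 → ‖y‖ ≤ 1 →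
      δ * ‖x - y‖ ≤ δ * (η / 2) + 2 * (2 * (‖x‖ ^ 2 + ‖y‖ ^ 2) - ‖x + y‖ ^ 2) := by
    intro x y hx hy
    by_cases h : η / 2 ≤ ‖x - y‖
    · have h1 := hconv x y hx hy h
      have h2 : ‖x - y‖ ≤ 2 := (norm_sub_le x y).trans (by linarith)
      nlinarith
    · push Not at h
      have := norm_add_sq_le_two_mul x y
      nlinarith
  refine ⟨δ * η / 16, by positivity, a, fun r => ?_⟩
  induction r with
  | zero =>
    have hZ : ∀ i, ‖((if i = s then 1 else 0) - k⁻¹ : ℂ) • x‖ ≤ 1 := fun i => by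
      have h1 : ((if i = s then 1 else 0) - k⁻¹ : ℂ) =
          (((if i = s then 1 else 0) - ((Fintype.card ι : ℕ) : ℝ)⁻¹ : ℝ) : ℂ) := by
        split_ifs <;> simp [hk]
      have h2 : (1 : ℝ) ≤ (Fintype.card ι : ℕ) := by exact_mod_cast Fintype.card_pos
      have h3 := inv_le_one_of_one_le₀ h2
      have h4 : 0 ≤ ((Fintype.card ι : ℕ) : ℝ)⁻¹ := by positivity
      rw [norm_smul, h1, Complex.norm_real, Real.norm_eq_abs]
      refine mul_le_one₀ ?_ (norm_nonneg x) hx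
      split_ifs <;> rw [abs_le] <;> constructor <;> linarith
    -- Centring the indicator of `s` gives mean zero, while harmonicity turns the mean of `φ (U i (Z
    -- i))` into `(φ (U s x) - φ x) / k = a`.
    refine ⟨ι, inferInstance, inferInstance, U, fun i => ((if i = s then 1 else 0) - k⁻¹) • x,
      hZ, ?_, hφ, ?_, ?_⟩
    · rw [← Finset.sum_smul]
      simp [← hk, hk0]
    · simp only [map_smul, smul_eq_mul, sub_mul, Finset.sum_sub_distrib, ← Finset.mul_sum, hφ]
      simp only [ite_mul, one_mul, zero_mul, Finset.sum_ite_eq', Finset.mem_univ, if_true, ← hk, ha]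
      field_simp
    · refine (Finset.sum_le_sum fun i _ => pow_le_one₀ (n := 2) (norm_nonneg _) (hZ i)).trans ?_
      simp
  | succ r ih =>
    obtain ⟨Ω, _, _, W, Z, hZ1, hZ0, hW, hWZ, hZ2⟩ := ih
    have hsymm : ∀ ω ω', ‖(W ω).symm (Z ω')‖ = ‖Z ω'‖ := fun ω ω' => by simp
    -- Two independent copies of the walk are composed, and `Z` is averaged with the second copy
    -- pulled back through the first. Harmonicity and mean zero preserve both the zero mean and the
    -- value `a`.
    refine ⟨Ω × Ω, inferInstance, inferInstance, fun p => (W p.1).trans (W p.2),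
      fun p => (2⁻¹ : ℂ) • (Z p.1 + (W p.1).symm (Z p.2)), fun p => ?_, ?_, fun y => ?_, ?_, ?_⟩
    · rw [norm_smul]
      have h1 := norm_add_le (Z p.1) ((W p.1).symm (Z p.2))
      rw [hsymm] at h1
      have := hZ1 p.1
      have := hZ1 p.2
      simp only [norm_inv, Complex.norm_ofNat]
      linarith
    · rw [← Finset.smul_sum, Fintype.sum_prod_type]
      simp [Finset.sum_add_distrib, ← map_sum, hZ0]
      simp [← Finset.smul_sum, hZ0]
    · simp only [Fintype.sum_prod_type, LinearIsometryEquiv.trans_apply, hW, ← Finset.mul_sum]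
      simp [Fintype.card_prod, mul_assoc]
    · simp only [Fintype.sum_prod_type, LinearIsometryEquiv.trans_apply, map_smul, map_add,
        LinearIsometryEquiv.apply_symm_apply, smul_eq_mul, ← Finset.mul_sum,
        Finset.sum_add_distrib, hW, hWZ, Finset.sum_const, Finset.card_univ, Fintype.card_prod,
        nsmul_eq_mul]
      push_cast
      ring
    · set n : ℝ := ((Fintype.card Ω : ℕ) : ℝ) with hn
      have hn0 : 0 < n := by simp [hn, Fintype.card_pos]
      have hsum : ∑ p : Ω × Ω, φ (W p.1 (Z p.1 - (W p.1).symm (Z p.2))) =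
          (Fintype.card Ω : ℂ) * (Fintype.card Ω * a) := by
        have hφZ : ∑ ω, φ (Z ω) = 0 := by rw [← map_sum, hZ0, map_zero]
        simp only [Fintype.sum_prod_type, map_sub, LinearIsometryEquiv.apply_symm_apply,
          Finset.sum_sub_distrib, Finset.sum_const, Finset.card_univ, nsmul_eq_mul,
          ← Finset.mul_sum, hWZ, hφZ, mul_zero, sub_zero]
      -- After `W p.1`, the functional `φ` of the difference has mean `a - 0`. So the two averaged
      -- vectors are on average at least `‖a‖ / ‖φ‖` apart, which forces a definite loss in the
      -- second moment of their midpoint.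
      have hlow : n * n * η ≤ ∑ p : Ω × Ω, ‖Z p.1 - (W p.1).symm (Z p.2)‖ := by
        have h1 : ‖∑ p : Ω × Ω, φ (W p.1 (Z p.1 - (W p.1).symm (Z p.2)))‖ ≤
            ‖φ‖ * ∑ p : Ω × Ω, ‖Z p.1 - (W p.1).symm (Z p.2)‖ := by
          rw [Finset.mul_sum]
          refine norm_sum_le_of_le _ fun p _ => (φ.le_opNorm _).trans ?_
          rw [LinearIsometryEquiv.norm_map]
        rw [hsum, norm_mul, norm_mul, Complex.norm_natCast, ← hn] at h1
        rw [hη, ← mul_div_assoc, div_le_iff₀ hφ0]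
        linarith
      have hsq : ∑ p : Ω × Ω, (‖Z p.1‖ ^ 2 + ‖(W p.1).symm (Z p.2)‖ ^ 2) =
          2 * n * ∑ ω, ‖Z ω‖ ^ 2 := by
        simp only [hsymm, Fintype.sum_prod_type, Finset.sum_add_distrib, Finset.sum_const,
          Finset.card_univ, nsmul_eq_mul, ← Finset.mul_sum, ← hn]
        ring
      have hkey := Finset.sum_le_sum fun (p : Ω × Ω) (_ : p ∈ Finset.univ) =>
        key (Z p.1) ((W p.1).symm (Z p.2)) (hZ1 p.1) (by rw [hsymm]; exact hZ1 p.2)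
      rw [← Finset.mul_sum, Finset.sum_add_distrib, Finset.sum_const, ← Finset.mul_sum,
        Finset.sum_sub_distrib, ← Finset.mul_sum, hsq, Finset.card_univ, Fintype.card_prod,
        nsmul_eq_mul, Nat.cast_mul, ← hn] at hkey
      simp only [norm_smul, norm_inv, Complex.norm_ofNat, mul_pow, ← Finset.mul_sum,
        Fintype.card_prod, Nat.cast_mul, ← hn]
      push_cast
      have h3 := mul_le_mul_of_nonneg_left hlow hδ.le
      have h4 := mul_le_mul_of_nonneg_left hZ2 hn0.le
      nlinarith

/-- On a uniformly convex space, a functional which is harmonic for a finite family of invertible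
isometries is invariant under all of them. -/
theorem invariant_of_harmonic {ι : Type u} [Fintype ι] [UniformConvexSpace B]
    (U : ι → B ≃ₗᵢ[ℂ] B) (φ : StrongDual ℂ B)
    (hφ : ∀ y, ∑ i, φ (U i y) = Fintype.card ι * φ y) (s : ι) (x : B) : φ (U s x) = φ x := by
  have : Nonempty ι := ⟨s⟩
  suffices h : ∀ x : B, ‖x‖ ≤ 1 → φ (U s x) = φ x by
    by_cases hx : x = 0
    · simp [hx]
    · have hx0 : (‖x‖ : ℂ) ≠ 0 := by simpa using hx
      have := h ((‖x‖ : ℂ)⁻¹ • x) (by simp [norm_smul, hx])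
      simpa [hx] using this
  intro x hx
  by_contra hne
  obtain ⟨δ, hδ, a, h⟩ := exists_random_vector_of_harmonic U φ x hx hφ s hne
  obtain ⟨r, hr⟩ := exists_nat_gt (1 / δ)
  obtain ⟨Ω, _, _, W, Z, -, -, -, -, hZ⟩ := h r
  have h0 : 0 ≤ ∑ ω, ‖Z ω‖ ^ 2 := Finset.sum_nonneg fun _ _ => by positivity
  have hc : (0 : ℝ) < Fintype.card Ω := by exact_mod_cast Fintype.card_pos
  rw [div_lt_iff₀ hδ] at hr
  nlinarith

end Harmonic

/-! ### Covering an entourage by finitely many involutions -/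

section Flips

variable {X : Type u} [EMetricSpace X]

/-- A space of bounded geometry has finite colourings separating points at bounded distance. -/
lemma exists_separating_coloring [BoundedGeometry X] (S : ℝ≥0) :
    ∃ (K : ℕ) (χ : X → Fin (K + 1)), ∀ x y, χ x = χ y → edist x y ≤ S → x = y := by
  classical
  obtain ⟨N, hN⟩ := BoundedGeometry.exists_bound (X := X) S
  have hfin : ∀ x, {y : X | edist x y ≤ S}.Finite := fun x => Set.finite_of_encard_le_coe (hN x)
  have wf : WellFounded (WellOrderingRel : X → X → Prop) := IsWellFounded.wf
  have hex : ∀ (x : X) (c : ∀ y, WellOrderingRel y x → Fin (N + 1)),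
      ∃ a, ∀ y (hy : WellOrderingRel y x), edist x y ≤ S → c y hy ≠ a := by
    intro x c
    -- Greedy colouring along a well-order: the ball around `x` has at most `N` points, so one of
    -- the `N + 1` colours is free.
    set F : Finset (Fin (N + 1)) :=
      (hfin x).toFinset.image fun y => if hy : WellOrderingRel y x then c y hy else 0
    have hF : F.card < Fintype.card (Fin (N + 1)) := by
      refine Finset.card_image_le.trans_lt ?_
      have := hN x
      rw [(hfin x).encard_eq_coe_toFinset_card] at this
      rw [Fintype.card_fin]
      exact Nat.lt_succ_of_le (by exact_mod_cast this)
    obtain ⟨a, ha⟩ := Finset.exists_mem_notMem_of_card_lt_card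
      (s := F) (t := Finset.univ) (by simpa using hF)
    refine ⟨a, fun y hy hxy h => ha.2 (Finset.mem_image.2 ⟨y, by simpa using hxy, ?_⟩)⟩
    rw [dif_pos hy, h]
  set χ : X → Fin (N + 1) := wf.fix fun x c => (hex x c).choose with hχ
  have hlt : ∀ x y, WellOrderingRel y x → edist x y ≤ S → χ y ≠ χ x := by
    intro x y hy hxy
    have := (hex x fun y _ => χ y).choose_spec y hy hxy
    rw [hχ, wf.fix_eq _ x]
    exact this
  refine ⟨N, χ, fun x y h hxy => ?_⟩
  rcases trichotomous_of WellOrderingRel x y with h' | h' | h'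
  · exact (hlt y x h' (by rwa [edist_comm]) h).elim
  · exact h'
  · exact (hlt x y h' hxy h.symm).elim

/-- An involution of `X` which moves points by a bounded distance. -/
structure Flip (X : Type u) [EMetricSpace X] where
  /-- The underlying map. -/
  toFun : X → X
  involutive : Function.Involutive toFun
  bounded : ∃ R : ℝ≥0, ∀ x, edist x (toFun x) ≤ R

instance : CoeFun (Flip X) fun _ => X → X := ⟨Flip.toFun⟩

/-- A symmetric entourage of a space of bounded geometry is covered by the graphs of finitely many
involutions, which move points only along the entourage. -/
lemma exists_flips [BoundedGeometry X] {E : Set (X × X)} (hE : IsEntourage E)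
    (hsymm : ∀ x y : X, (x, y) ∈ E → (y, x) ∈ E) :
    ∃ (K : ℕ) (σ : Fin (K + 1) × Fin (K + 1) → Flip X), (∀ x y, (x, y) ∈ E → ∃ i, σ i x = y) ∧
      ∀ i x, σ i x ≠ x → (x, σ i x) ∈ E := by
  classical
  obtain ⟨R, hR⟩ := hE
  -- Two `E`-neighbours of the same point are within `R + R`, so equal colours force them to
  -- coincide. For a fixed unordered pair of colours the edges of `E` therefore form a matching,
  -- which is swapped by an involution fixing all other points.
  obtain ⟨K, χ, hχ⟩ := exists_separating_coloring (X := X) (R + R)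
  let r : Fin (K + 1) × Fin (K + 1) → X → X → Prop := fun i x y =>
    (x, y) ∈ E ∧ ((χ x = i.1 ∧ χ y = i.2) ∨ (χ x = i.2 ∧ χ y = i.1))
  have hrs : ∀ i x y, r i x y → r i y x := fun i x y h => ⟨hsymm x y h.1, by tauto⟩
  have hru : ∀ i x y y', r i x y → r i x y' → y = y' := by
    intro i x y y' h h'
    refine hχ y y' ?_ ?_
    · rcases h.2 with ⟨h1, h2⟩ | ⟨h1, h2⟩ <;> rcases h'.2 with ⟨h3, h4⟩ | ⟨h3, h4⟩ <;>
        simp_all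
    · push_cast
      refine (edist_triangle y x y').trans (add_le_add ?_ (hR _ h'.1))
      rw [edist_comm]
      exact hR _ h.1
  let f : Fin (K + 1) × Fin (K + 1) → X → X := fun i x =>
    if h : ∃ y, r i x y then h.choose else x
  have hf : ∀ i x y, r i x y → f i x = y := by
    intro i x y h
    have hex : ∃ y, r i x y := ⟨y, h⟩
    simp only [f, dif_pos hex]
    exact hru i x _ _ hex.choose_spec h
  have hf' : ∀ i x, f i x ≠ x → r i x (f i x) := by
    intro i x h
    by_cases hex : ∃ y, r i x y
    · obtain ⟨y, hy⟩ := hex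
      rwa [hf i x y hy]
    · exact (h (by simp only [f, dif_neg hex])).elim
  refine ⟨K, fun i => ⟨f i, fun x => ?_, R, fun x => ?_⟩, fun x y h => ⟨(χ x, χ y), ?_⟩,
    fun i x h => (hf' i x h).1⟩
  · by_cases h : f i x = x
    · rw [h, h]
    · exact hf i _ _ (hrs i _ _ (hf' i x h))
  · by_cases h : f i x = x
    · simp [h]
    · exact hR _ (hf' i x h).1
  · exact hf _ x y ⟨h, Or.inl ⟨rfl, rfl⟩⟩

end Flips

lemma norm_ellInfty_one_le (Y : Type*) : ‖(1 : EllInfty Y)‖ ≤ 1 :=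
  lp.norm_le_of_forall_le zero_le_one fun x => by simp [lp.infty_coeFn_one]

/-! ### Matrix calculus for flips, row sums and adjoints -/

namespace Roe

section Basic

variable {X : Type u} [EMetricSpace X]

/-- The permutation matrix of a flip. -/
def ofFlip (σ : Flip X) : Roe X := by
  classical
  exact ofMatrix (fun x y => if σ x = y then 1 else 0) ⟨1, fun x y => by split_ifs <;> simp⟩
    (by
      obtain ⟨R, hR⟩ := σ.bounded
      refine ⟨R, fun x y h => ?_⟩
      have hxy : σ x = y := by by_contra h'; simp [h'] at h
      exact hxy ▸ hR x)

open Classical in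
lemma entry_ofFlip (σ : Flip X) (x y : X) :
    (ofFlip σ).entry x y = if σ x = y then 1 else 0 := by
  show (if σ x = y then (1 : ℂ) else 0) = _
  congr

/-- The part of a matrix supported in a given set. -/
def restrict (T : Roe X) (A : Set (X × X)) : Roe X := by
  classical
  exact ofMatrix (fun x y => if (x, y) ∈ A then T.entry x y else 0)
    (by
      obtain ⟨M, hM⟩ := T.entry_bounded
      refine ⟨|M|, fun x y => ?_⟩
      split_ifs
      · exact (hM x y).trans (le_abs_self M)
      · simp)
    (by
      obtain ⟨R, hR⟩ := T.finite_propagation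
      exact ⟨R, fun x y h => hR x y fun h0 => h (by simp [h0])⟩)

open Classical in
lemma entry_restrict (T : Roe X) (A : Set (X × X)) (x y : X) :
    (T.restrict A).entry x y = if (x, y) ∈ A then T.entry x y else 0 := by
  show (if (x, y) ∈ A then T.entry x y else 0) = _
  congr

lemma entry_sum {ι : Type*} (s : Finset ι) (T : ι → Roe X) (x y : X) :
    (∑ i ∈ s, T i).entry x y = ∑ i ∈ s, (T i).entry x y := by
  classical
  induction s using Finset.induction_on with
  | empty => simp
  | insert i s hi ih => rw [Finset.sum_insert hi, Finset.sum_insert hi, entry_add, ih]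

lemma entry_sub (T S : Roe X) (x y : X) : (T - S).entry x y = T.entry x y - S.entry x y := rfl

lemma entry_adj (T : Roe X) (x y : X) : T.adj.entry x y = star (T.entry y x) := rfl

lemma diag_add (f g : EllInfty X) : diag (f + g) = diag f + diag g := by
  ext x y
  by_cases h : x = y <;> simp [entry_diag, h]

lemma diag_one : diag (1 : EllInfty X) = 1 := by
  ext x y
  simp [entry_diag, entry_one]

lemma diag_zero : diag (0 : EllInfty X) = 0 := by
  ext x y
  simp [entry_diag]

lemma diag_sum {ι : Type*} (s : Finset ι) (f : ι → EllInfty X) :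
    diag (∑ i ∈ s, f i) = ∑ i ∈ s, diag (f i) :=
  map_sum (AddMonoidHom.mk' (diag (X := X)) diag_add) f s

lemma adj_add (T S : Roe X) : (T + S).adj = T.adj + S.adj := by
  ext x y
  simp [entry_adj]

lemma isPartialTranslation_ofFlip (σ : Flip X) : (ofFlip σ).IsPartialTranslation where
  zero_or_one x y := by
    rw [entry_ofFlip]
    split_ifs <;> simp
  row x y y' h h' := by
    simp only [entry_ofFlip, ne_eq, ite_eq_right_iff, one_ne_zero, imp_false, not_not] at h h'
    rw [← h, h']
  col x x' y h h' := by
    simp only [entry_ofFlip, ne_eq, ite_eq_right_iff, one_ne_zero, imp_false, not_not] at h h'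
    exact σ.involutive.injective (h.trans h'.symm)

lemma isPartialTranslation_one : (1 : Roe X).IsPartialTranslation where
  zero_or_one x y := by
    rw [entry_one]
    split_ifs <;> simp
  row x y y' h h' := by
    simp only [entry_one, ne_eq, ite_eq_right_iff, one_ne_zero, imp_false, not_not] at h h'
    rw [← h, h']
  col x x' y h h' := by
    simp only [entry_one, ne_eq, ite_eq_right_iff, one_ne_zero, imp_false, not_not] at h h'
    rw [h, h']

end Basic

variable {X : Type u} [EMetricSpace X] [BoundedGeometry X]

lemma entry_mul_ofFlip (T : Roe X) (σ : Flip X) (x y : X) :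
    (T * ofFlip σ).entry x y = T.entry x (σ y) := by
  rw [entry_mul, finsum_eq_single _ (σ y)]
  · simp [entry_ofFlip, σ.involutive y]
  · intro z hz
    rw [entry_ofFlip, if_neg, mul_zero]
    rintro rfl
    exact hz (σ.involutive z).symm

lemma entry_ofFlip_mul (T : Roe X) (σ : Flip X) (x y : X) :
    (ofFlip σ * T).entry x y = T.entry (σ x) y := by
  rw [entry_mul, finsum_eq_single _ (σ x)]
  · simp [entry_ofFlip]
  · intro z hz
    rw [entry_ofFlip, if_neg hz.symm, zero_mul]

lemma entry_diag_mul (f : EllInfty X) (T : Roe X) (x y : X) :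
    (diag f * T).entry x y = f x * T.entry x y := by
  rw [entry_mul, finsum_eq_single _ x]
  · simp [entry_diag]
  · intro z hz
    rw [entry_diag, if_neg hz.symm, zero_mul]

lemma ofFlip_mul_self (σ : Flip X) : ofFlip σ * ofFlip σ = 1 := by
  ext x y
  rw [entry_mul_ofFlip, entry_ofFlip, entry_one]
  congr 1
  exact propext σ.involutive.injective.eq_iff

/-- In the dual action the flip thereby lands next to the functional, which absorbs it when it is
flip-invariant. -/
lemma adj_mul_ofFlip (T : Roe X) (σ : Flip X) : (T * ofFlip σ).adj = ofFlip σ * T.adj := by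
  ext x y
  rw [entry_adj, entry_mul_ofFlip, entry_ofFlip_mul, entry_adj]

lemma rowSum_apply (T : Roe X) (x : X) : T.rowSum x = ∑ᶠ y, T.entry x y := rfl

lemma rowSum_add (T S : Roe X) : (T + S).rowSum = T.rowSum + S.rowSum := by
  have hfin : ∀ (T : Roe X) (x : X), (Function.support (T.entry x)).Finite := fun T x => by
    obtain ⟨_, h⟩ := T.exists_row_finset
    obtain ⟨F, -, hF⟩ := h x
    exact F.finite_toSet.subset fun z hz => hF z hz
  ext x
  change (T + S).rowSum x = T.rowSum x + S.rowSum x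
  rw [rowSum_apply, rowSum_apply, rowSum_apply]
  exact finsum_add_distrib (hfin T x) (hfin S x)

lemma rowSum_diag (f : EllInfty X) : (diag f).rowSum = f := by
  ext x
  rw [rowSum_apply, finsum_eq_single _ x]
  · simp [entry_diag]
  · intro z hz
    rw [entry_diag, if_neg hz.symm]

lemma rowSum_sub (T S : Roe X) : (T - S).rowSum = T.rowSum - S.rowSum := by
  rw [eq_sub_iff_add_eq, ← rowSum_add, sub_add_cancel]

/-- Right multiplication by a flip only permutes columns. This is why `induction_flips` multiplies
on the right. -/
lemma rowSum_mul_ofFlip (T : Roe X) (σ : Flip X) : (T * ofFlip σ).rowSum = T.rowSum := by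
  ext x
  rw [rowSum_apply, rowSum_apply, finsum_congr fun y => entry_mul_ofFlip T σ x y]
  exact finsum_comp_equiv (f := fun y => T.entry x y) σ.involutive.toPerm

lemma rowSum_ofFlip (σ : Flip X) : (ofFlip σ).rowSum = 1 := by
  rw [← one_mul (ofFlip σ), rowSum_mul_ofFlip, ← diag_one, rowSum_diag]

lemma rowSum_sum {ι : Type*} (s : Finset ι) (T : ι → Roe X) :
    (∑ i ∈ s, T i).rowSum = ∑ i ∈ s, (T i).rowSum :=
  map_sum (AddMonoidHom.mk' (rowSum (X := X)) rowSum_add) T s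

/-- Induction principle: `ℂ_u[X]` is generated by the diagonal matrices under sums and
multiplication on the right by flips covering a generating entourage. -/
theorem induction_flips {E : Set (X × X)} (hE : IsSymmGenerating E) {ι : Type*} [Fintype ι] [Nonempty ι]
    {σ : ι → Flip X} (hσ : ∀ x y, (x, y) ∈ E → ∃ i, σ i x = y) {C : Roe X → Prop}
    (hdiag : ∀ f, C (diag f)) (hadd : ∀ T S, C T → C S → C (T + S))
    (hmul : ∀ T i, C T → C (T * ofFlip (σ i))) (T : Roe X) : C T := by
  classical
  have hsum : ∀ (s : Finset ι) (T : ι → Roe X), (∀ i, C (T i)) → C (∑ i ∈ s, T i) :=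
    fun s T hT => Finset.sum_induction T C hadd (diag_zero (X := X) ▸ hdiag 0) fun i _ => hT i
  have step : ∀ F : Set (X × X), (∀ T : Roe X, T.supp ⊆ F → C T) →
      ∀ T : Roe X, T.supp ⊆ relComp F E → C T := by
    intro F hF T hT
    have hex : ∀ p : X × X, ∃ i : ι, T.entry p.1 p.2 ≠ 0 → (p.1, σ i p.2) ∈ F := by
      intro p
      by_cases h : T.entry p.1 p.2 = 0
      · exact ⟨Classical.arbitrary ι, fun h' => (h' h).elim⟩
      · obtain ⟨z, hz, hz'⟩ := hT h
        obtain ⟨i, hi⟩ := hσ _ _ (hE.symm _ _ hz')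
        exact ⟨i, fun _ => hi ▸ hz⟩
    choose c hc using hex
    have hTsum : T = ∑ i, T.restrict {p | c p = i} := by
      ext x y
      simp [entry_sum, entry_restrict]
    rw [hTsum]
    refine hsum _ _ fun i => ?_
    -- The inner product with the flip undoes the last step along `E`, so its support lies in `F`;
    -- the outer flip restores the matrix.
    have : T.restrict {p | c p = i} = T.restrict {p | c p = i} * ofFlip (σ i) * ofFlip (σ i) := by
      rw [mul_assoc, ofFlip_mul_self, mul_one]
    rw [this]
    refine hmul _ i (hF _ ?_)
    rintro ⟨x, y⟩ hp
    simp only [supp, Set.mem_ofPred_eq, entry_mul_ofFlip, entry_restrict, ne_eq,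
      ite_eq_right_iff, not_forall] at hp
    obtain ⟨h1, h2⟩ := hp
    have := hc (x, σ i y) h2
    rw [h1] at this
    simpa [(σ i).involutive y] using this
  have hdiag' : ∀ T : Roe X, T.supp ⊆ {p | p.1 = p.2} → C T := by
    intro T hT
    have : T = diag T.rowSum := by
      have hne : ∀ x y, x ≠ y → T.entry x y = 0 := fun x y h => by
        by_contra h0
        exact h (hT (show (x, y) ∈ T.supp from h0))
      ext x y
      rw [entry_diag, rowSum_apply, finsum_eq_single _ x fun z hz => hne x z hz.symm]
      split_ifs with h
      · rw [h]
      · exact hne x y h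
    rw [this]
    exact hdiag _
  have hpow : ∀ n, ∀ T : Roe X, T.supp ⊆ relPow E n → C T := by
    intro n
    induction n with
    | zero =>
      -- `relPow E 0` is `E` itself, so the base case is one step from the diagonal.
      refine fun T hT => step _ hdiag' T fun p hp => ⟨p.1, rfl, hT hp⟩
    | succ n ih => exact step _ ih
  obtain ⟨R, hR⟩ := T.finite_propagation
  obtain ⟨n, hn⟩ := hE.generates T.supp ⟨R, fun p hp => hR _ _ hp⟩
  exact hpow n T hn

/-- A partial translation supported in an entourage covered by flips decomposes along the flips. -/
lemma IsPartialTranslation.exists_eq_sum {E : Set (X × X)} {ι : Type*} [Fintype ι] [Nonempty ι]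
    {σ : ι → Flip X} (hσ : ∀ x y, (x, y) ∈ E → ∃ i, σ i x = y) {V : Roe X}
    (hV : V.IsPartialTranslation) (hVE : V.supp ⊆ E) :
    ∃ a : ι → EllInfty X, (∀ i, ‖a i‖ ≤ 1) ∧ V = ∑ i, diag (a i) * ofFlip (σ i) := by
  classical
  have hex : ∀ p : X × X, ∃ i : ι, V.entry p.1 p.2 ≠ 0 → σ i p.1 = p.2 := by
    intro p
    by_cases h : V.entry p.1 p.2 = 0
    · exact ⟨Classical.arbitrary ι, fun h' => (h' h).elim⟩
    · obtain ⟨i, hi⟩ := hσ _ _ (hVE h)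
      exact ⟨i, fun _ => hi⟩
  choose c hc using hex
  -- Several flips may pass through the same entry of `V`; the choice `c` ensures that each entry is
  -- counted once.
  let f : ι → X → ℂ := fun i x => if c (x, σ i x) = i then V.entry x (σ i x) else 0
  have hf : ∀ i x, ‖f i x‖ ≤ 1 := by
    intro i x
    simp only [f]
    split_ifs
    · rcases hV.zero_or_one x (σ i x) with h | h <;> simp [h]
    · simp
  refine ⟨fun i => ⟨f i, memℓp_infty ⟨1, ?_⟩⟩, fun i => ?_, ?_⟩
  · rintro _ ⟨x, rfl⟩
    exact hf i x
  · exact lp.norm_le_of_forall_le zero_le_one (hf i)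
  · ext x y
    have hterm : ∀ i, (diag (⟨f i, memℓp_infty ⟨1, by rintro _ ⟨x, rfl⟩; exact hf i x⟩⟩ :
        EllInfty X) * ofFlip (σ i)).entry x y = if c (x, y) = i then V.entry x y else 0 := by
      intro i
      rw [entry_diag_mul, entry_ofFlip]
      show f i x * _ = _
      simp only [f]
      by_cases h : σ i x = y
      · simp [h]
      · rw [if_neg h, mul_zero]
        split_ifs with hi
        · by_contra h0
          exact h (hi ▸ hc (x, y) (Ne.symm h0))
        · rfl
    simp only [entry_sum, hterm]
    simp

lemma ellOneNorm_diag_mul_le (f : EllInfty X) {V : Roe X} (hV : V.IsPartialTranslation) :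
    (diag f * V).ellOneNorm ≤ ‖f‖ := by
  refine csInf_le ⟨0, ?_⟩ ⟨1, fun _ => f, fun _ => V, fun _ => hV, by simp, by simp⟩
  rintro _ ⟨n, g, W, -, -, rfl⟩
  exact Finset.sum_nonneg fun _ _ => norm_nonneg _

lemma ellOneNorm_ofFlip_le (σ : Flip X) : (ofFlip σ).ellOneNorm ≤ 1 := by
  have := ellOneNorm_diag_mul_le 1 (isPartialTranslation_ofFlip σ)
  rw [diag_one, one_mul] at this
  exact this.trans (norm_ellInfty_one_le X)

lemma ellOneNorm_diag_le (f : EllInfty X) : (diag f).ellOneNorm ≤ ‖f‖ := by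
  simpa using ellOneNorm_diag_mul_le f isPartialTranslation_one

/-- The part of a flip that moves points is a partial translation `V` with
`V - Φ(V)` equal to the flip minus the identity. -/
lemma exists_isPartialTranslation_sub_eq (σ : Flip X) :
    ∃ V : Roe X, V.IsPartialTranslation ∧ (∀ x y, V.entry x y ≠ 0 → σ x = y ∧ σ x ≠ x) ∧
      V - diag V.rowSum = ofFlip σ - 1 := by
  classical
  -- Deleting the fixed points changes the flip and the diagonal of its row sums by the same matrix
  -- `diag g`, so their difference stays `ofFlip σ - 1`.
  let f : X → ℂ := fun x => if σ x = x then 1 else 0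
  let g : EllInfty X := ⟨f, memℓp_infty ⟨1, by
    rintro _ ⟨x, rfl⟩
    simp only [f]
    split_ifs <;> simp⟩⟩
  have hg : ∀ x, g x = if σ x = x then 1 else 0 := fun x => rfl
  have hentry : ∀ x y, (ofFlip σ - diag g).entry x y = if σ x = y ∧ σ x ≠ x then 1 else 0 := by
    intro x y
    rw [entry_sub, entry_ofFlip, entry_diag, hg]
    by_cases h1 : σ x = y <;> by_cases h2 : x = y
    · subst h2; simp [h1]
    · have : σ x ≠ x := by rw [h1]; exact Ne.symm h2
      simp [h1, h2, Ne.symm h2]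
    · subst h2; simp [h1]
    · simp [h1, h2]
  have hne : ∀ x y, (ofFlip σ - diag g).entry x y ≠ 0 → σ x = y ∧ σ x ≠ x := by
    intro x y h
    rw [hentry] at h
    by_contra h'
    exact h (if_neg h')
  refine ⟨ofFlip σ - diag g, ⟨fun x y => ?_, fun x y y' h h' => ?_, fun x x' y h h' => ?_⟩,
    hne, ?_⟩
  · rw [hentry]
    split_ifs <;> simp
  · rw [← (hne _ _ h).1, (hne _ _ h').1]
  · exact σ.involutive.injective ((hne _ _ h).1.trans (hne _ _ h').1.symm)
  · rw [rowSum_sub, rowSum_ofFlip, rowSum_diag]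
    have : diag (1 - g) = 1 - diag g := by
      rw [eq_sub_iff_add_eq, ← diag_add, sub_add_cancel, diag_one]
    rw [this]
    abel

end Roe

/-! ### Representations, flips and invariants -/

lemma Roe.adj_one {X : Type u} [EMetricSpace X] : (1 : Roe X).adj = 1 := by
  ext x y
  rw [entry_adj, entry_one, entry_one]
  by_cases hxy : x = y
  · simp [hxy]
  · simp [hxy, Ne.symm hxy]

lemma Roe.adj_ofFlip {X : Type u} [EMetricSpace X] [BoundedGeometry X] (σ : Flip X) :
    (ofFlip σ).adj = ofFlip σ := by
  rw [← one_mul (ofFlip σ), adj_mul_ofFlip, adj_one, mul_one, one_mul]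

namespace RoeRep

open Roe

variable {X : Type u} [EMetricSpace X] [BoundedGeometry X] {B : Type v}
  [NormedAddCommGroup B] [NormedSpace ℂ B] (π : RoeRep X B)

lemma norm_ofFlip_apply_le (σ : Flip X) (ξ : B) : ‖π.toAlgHom (ofFlip σ) ξ‖ ≤ ‖ξ‖ := by
  simpa using (π.toAlgHom (ofFlip σ)).le_of_opNorm_le
    ((π.contractive _).trans (ellOneNorm_ofFlip_le σ)) ξ

lemma ofFlip_ofFlip_apply (σ : Flip X) (ξ : B) :
    π.toAlgHom (ofFlip σ) (π.toAlgHom (ofFlip σ) ξ) = ξ := by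
  rw [← mul_apply_eq_comp, ← map_mul, ofFlip_mul_self, map_one,
    one_apply_eq_self]

/-- The invertible isometry by which a flip acts. -/
def flipEquiv (σ : Flip X) : B ≃ₗᵢ[ℂ] B where
  toLinearEquiv := LinearEquiv.ofInvolutive (π.toAlgHom (ofFlip σ) : B →ₗ[ℂ] B)
    (π.ofFlip_ofFlip_apply σ)
  norm_map' ξ := le_antisymm (π.norm_ofFlip_apply_le σ ξ) (by
    conv_lhs => rw [← π.ofFlip_ofFlip_apply σ ξ]
    exact π.norm_ofFlip_apply_le σ _)

lemma flipEquiv_apply (σ : Flip X) (ξ : B) : π.flipEquiv σ ξ = π.toAlgHom (ofFlip σ) ξ := rfl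

lemma norm_ofFlip_apply (σ : Flip X) (ξ : B) : ‖π.toAlgHom (ofFlip σ) ξ‖ = ‖ξ‖ :=
  (π.flipEquiv σ).norm_map ξ

lemma toAlgHom_diag_one : π.toAlgHom (diag 1) = 1 := by rw [diag_one, map_one]

section Generating

variable {E : Set (X × X)} {ι : Type*} [Fintype ι] [Nonempty ι] {σ : ι → Flip X}

/-- The invariant vectors are those fixed by flips covering a generating entourage. -/
lemma mem_invariants_iff (hE : IsSymmGenerating E) (hσ : ∀ x y, (x, y) ∈ E → ∃ i, σ i x = y)
    {ξ : B} : ξ ∈ π.invariants ↔ ∀ i, π.toAlgHom (ofFlip (σ i)) ξ = ξ := by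
  constructor
  · intro h i
    rw [h _ (isPartialTranslation_ofFlip (σ i)), rowSum_ofFlip, toAlgHom_diag_one,
      one_apply_eq_self]
  · intro h V _
    refine induction_flips hE hσ
      (C := fun T => π.toAlgHom T ξ = π.toAlgHom (diag T.rowSum) ξ) ?_ ?_ ?_ V
    · intro f
      rw [rowSum_diag]
    · intro T S hT hS
      rw [rowSum_add, diag_add, map_add, map_add, add_apply,
        add_apply, hT, hS]
    · intro T i hT
      rw [rowSum_mul_ofFlip, map_mul, mul_apply_eq_comp, h i, hT]

/-- The invariant functionals are those fixed by flips covering a generating entourage. -/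
lemma mem_dualInvariants_iff (hE : IsSymmGenerating E)
    (hσ : ∀ x y, (x, y) ∈ E → ∃ i, σ i x = y) {f : StrongDual ℂ B} :
    f ∈ π.dualInvariants ↔ ∀ i ξ, f (π.toAlgHom (ofFlip (σ i)) ξ) = f ξ := by
  constructor
  · intro h i ξ
    have := DFunLike.congr_fun (h _ (isPartialTranslation_ofFlip (σ i))) ξ
    simpa [dualAct, adj_ofFlip, rowSum_ofFlip, diag_one, adj_one] using this
  · intro h V _
    refine induction_flips hE hσ
      (C := fun T => π.dualAct T f = π.dualAct (diag T.rowSum) f) ?_ ?_ ?_ V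
    · intro f
      rw [rowSum_diag]
    · intro T S hT hS
      have hadd : ∀ T S : Roe X, π.dualAct (T + S) f = π.dualAct T f + π.dualAct S f :=
        fun T S => by ext; simp [dualAct, adj_add]
      rw [rowSum_add, diag_add, hadd, hadd, hT, hS]
    · intro T i hT
      rw [rowSum_mul_ofFlip, ← hT]
      ext ξ
      simp [dualAct, adj_mul_ofFlip, h i]

/-- A partial translation covered by flips moves vectors at most as much as the flips do. -/
lemma norm_sub_le_sum (hσ : ∀ x y, (x, y) ∈ E → ∃ i, σ i x = y) {V : Roe X}
    (hV : V.IsPartialTranslation) (hVE : V.supp ⊆ E) (ξ : B) :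
    ‖π.toAlgHom V ξ - π.toAlgHom (diag V.rowSum) ξ‖ ≤
      ∑ i, ‖π.toAlgHom (ofFlip (σ i)) ξ - ξ‖ := by
  obtain ⟨a, ha, hVa⟩ := hV.exists_eq_sum hσ hVE
  have hrow : V.rowSum = ∑ i, a i := by
    simp only [hVa, rowSum_sum, rowSum_mul_ofFlip, rowSum_diag]
  -- Since `Φ(V) = ∑ a i`, the element `V - Φ(V)` is `∑ diag (a i) * (ofFlip (σ i) - 1)`, with
  -- contractive coefficients.
  have heq : π.toAlgHom V ξ - π.toAlgHom (diag V.rowSum) ξ =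
      ∑ i, π.toAlgHom (diag (a i)) (π.toAlgHom (ofFlip (σ i)) ξ - ξ) := by
    rw [hrow, diag_sum]
    conv_lhs => rw [hVa]
    simp [map_sum, Finset.sum_sub_distrib]
  rw [heq]
  refine norm_sum_le_of_le _ fun i _ => ?_
  simpa using (π.toAlgHom (diag (a i))).le_of_opNorm_le
    ((π.contractive _).trans ((ellOneNorm_diag_le _).trans (ha i))) (π.toAlgHom (ofFlip (σ i)) ξ - ξ)

end Generating

/-- A contraction fixing the invariant vectors moves a vector at most twice as much as its distance
to the invariant vectors. -/
lemma norm_sub_le_two_mul_norm_mk {T : B →L[ℂ] B} (hT : ‖T‖ ≤ 1)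
    (hfix : ∀ ξ ∈ π.invariants, T ξ = ξ) (ξ : B) :
    ‖T ξ - ξ‖ ≤ 2 * ‖(Submodule.Quotient.mk ξ : B ⧸ π.invariants)‖ := by
  refine le_of_forall_pos_le_add fun ε hε => ?_
  obtain ⟨ζ, hζ, hn⟩ := Submodule.Quotient.norm_mk_lt
    (Submodule.Quotient.mk ξ : B ⧸ π.invariants) (half_pos hε)
  have h := hfix _ ((Submodule.Quotient.eq _).1 hζ)
  rw [map_sub, sub_eq_sub_iff_sub_eq_sub] at h
  have h1 : T ξ - ξ = T ζ - ζ := h.symm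
  have h2 := T.le_of_opNorm_le hT ζ
  have h3 := norm_sub_le (T ζ) ζ
  rw [h1]
  linarith

end RoeRep

/-! ### The Markov operator -/

section Markov

open Roe RoeRep

variable {X : Type u} [EMetricSpace X] [BoundedGeometry X]

/-- The lazy Markov operator of a finite family of flips. -/
def markov {ι : Type*} [Fintype ι] (σ : ι → Flip X) : Roe X :=
  (2 * Fintype.card ι : ℂ)⁻¹ • ∑ i, (1 + ofFlip (σ i))

variable {ι : Type*} [Fintype ι] {σ : ι → Flip X} {B : Type v}
  [NormedAddCommGroup B] [NormedSpace ℂ B] (π : RoeRep X B)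

variable (σ) in
lemma markov_apply (ξ : B) : π.toAlgHom (markov σ) ξ =
    (2 * Fintype.card ι : ℂ)⁻¹ • ∑ i, (ξ + π.toAlgHom (ofFlip (σ i)) ξ) := by
  simp [markov, map_sum]

variable (σ) in
lemma norm_markov_apply_le (ξ : B) : ‖π.toAlgHom (markov σ) ξ‖ ≤
    (2 * Fintype.card ι : ℝ)⁻¹ * ∑ i, ‖ξ + π.toAlgHom (ofFlip (σ i)) ξ‖ := by
  rw [markov_apply, norm_smul]
  gcongr
  · simp
  · exact norm_sum_le _ _

variable [Nonempty ι]

variable (σ) in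
lemma norm_markov_le_one : ‖π.toAlgHom (markov σ)‖ ≤ 1 := by
  refine ContinuousLinearMap.opNorm_le_bound _ zero_le_one fun ξ => ?_
  refine (norm_markov_apply_le σ π ξ).trans ?_
  have hk : (0 : ℝ) < Fintype.card ι := by exact_mod_cast Fintype.card_pos
  have : ∑ i, ‖ξ + π.toAlgHom (ofFlip (σ i)) ξ‖ ≤ ∑ _i : ι, 2 * ‖ξ‖ :=
    Finset.sum_le_sum fun i _ => (norm_add_le _ _).trans (by rw [norm_ofFlip_apply]; linarith)
  rw [Finset.sum_const, Finset.card_univ, nsmul_eq_mul] at this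
  rw [inv_mul_le_iff₀ (by positivity)]
  linarith

lemma markov_apply_of_fixed {ξ : B} (h : ∀ i, π.toAlgHom (ofFlip (σ i)) ξ = ξ) :
    π.toAlgHom (markov σ) ξ = ξ := by
  have hk : (Fintype.card ι : ℂ) ≠ 0 := by simp
  simp only [markov_apply, h, Finset.sum_const, Finset.card_univ, ← two_smul ℂ ξ,
    ← Nat.cast_smul_eq_nsmul ℂ, smul_smul]
  rw [show (2 * Fintype.card ι : ℂ)⁻¹ * (Fintype.card ι * 2) = 1 by field_simp, one_smul]

/-- For a uniformly convex family with a uniform spectral gap, the Markov operator contracts the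
distance to the invariant vectors by a uniform factor. -/
lemma exists_markov_contraction {E : Set (X × X)} (hE : IsSymmGenerating E)
    (hσ : ∀ x y, (x, y) ∈ E → ∃ i, σ i x = y) {𝔅 : Set BanachSp.{v}}
    (hconv : UniformlyConvexFamily 𝔅) {c : ℝ} (hc : 0 < c) :
    ∃ l : ℝ, 0 ≤ l ∧ l < 1 ∧ ∀ B ∈ 𝔅, ∀ π : RoeRep X B, π.HasSpectralGap E c → ∀ ξ : B,
      ‖(Submodule.Quotient.mk (π.toAlgHom (markov σ) ξ) : B ⧸ π.invariants)‖ ≤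
        l * ‖(Submodule.Quotient.mk ξ : B ⧸ π.invariants)‖ := by
  classical
  set k : ℝ := ((Fintype.card ι : ℕ) : ℝ) with hkdef
  have hk : 1 ≤ k := by rw [hkdef]; exact_mod_cast Fintype.card_pos
  have hk0 : 0 < k := by linarith
  -- Some flip moves a representative `ζ` by at least `d * c / k`, where `d` is the quotient norm;
  -- normalising with `‖ζ‖ < 2 * d` leaves `c / (2 * k)`. The later `min δ 1` keeps the contraction
  -- factor nonnegative.
  obtain ⟨δ, hδ, h⟩ := hconv (c / (2 * k)) (by positivity)
  have hδ1 : min δ 1 / k ≤ 1 := (div_le_one hk0).2 ((min_le_right _ _).trans hk)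
  have hδ0 : 0 < min δ 1 / k := div_pos (lt_min hδ one_pos) hk0
  refine ⟨1 - min δ 1 / k, by linarith, by linarith, fun B hB π hgap ξ => ?_⟩
  set l : ℝ := 1 - min δ 1 / k with hl
  have hmk : ∀ ζ : B, ‖(Submodule.Quotient.mk ζ : B ⧸ π.invariants)‖ ≤ ‖ζ‖ := fun ζ =>
    Submodule.Quotient.norm_mk_le _ ζ
  -- replacing a vector by another representative of its class
  have hrep : ∀ ζ : B, (Submodule.Quotient.mk ζ : B ⧸ π.invariants) = Submodule.Quotient.mk ξ →
      ‖(Submodule.Quotient.mk (π.toAlgHom (markov σ) ξ) : B ⧸ π.invariants)‖ ≤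
        ‖π.toAlgHom (markov σ) ζ‖ := by
    intro ζ hζ
    have h1 := (Submodule.Quotient.eq _).1 hζ
    have h2 := markov_apply_of_fixed π ((π.mem_invariants_iff hE hσ).1 h1)
    have h3 : (Submodule.Quotient.mk (π.toAlgHom (markov σ) ζ) : B ⧸ π.invariants) =
        Submodule.Quotient.mk (π.toAlgHom (markov σ) ξ) := by
      rw [Submodule.Quotient.eq, ← map_sub, h2]
      exact h1
    rw [← h3]
    exact hmk _
  set d : ℝ := ‖(Submodule.Quotient.mk ξ : B ⧸ π.invariants)‖ with hd
  have hd0 : 0 ≤ d := norm_nonneg _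
  rcases hd0.eq_or_lt with hd' | hd'
  · rw [← hd', mul_zero]
    refine le_of_forall_pos_le_add fun ε hε => ?_
    obtain ⟨ζ, hζ, hn⟩ := Submodule.Quotient.norm_mk_lt
      (Submodule.Quotient.mk ξ : B ⧸ π.invariants) hε
    have h1 := (π.toAlgHom (markov σ)).le_of_opNorm_le (norm_markov_le_one σ π) ζ
    have h2 := hrep ζ hζ
    linarith
  have hclaim : ∀ ζ : B, (Submodule.Quotient.mk ζ : B ⧸ π.invariants) = Submodule.Quotient.mk ξ →
      ‖ζ‖ < 2 * d → ‖π.toAlgHom (markov σ) ζ‖ ≤ l * ‖ζ‖ := by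
    intro ζ hζ hn
    have hdζ : d ≤ ‖ζ‖ := by rw [hd, ← hζ]; exact hmk ζ
    have hζ0 : 0 < ‖ζ‖ := by linarith
    obtain ⟨V, hV, hVE, hVc⟩ := hgap (((d : ℂ)⁻¹) • ζ) (by
      rw [Submodule.Quotient.mk_smul, norm_smul, hζ, ← hd, norm_inv, Complex.norm_real,
        Real.norm_of_nonneg hd0, inv_mul_cancel₀ hd'.ne'])
    have h1 := hVc.trans ((hmk _).trans (π.norm_sub_le_sum hσ hV hVE _))
    simp only [map_smul, ← smul_sub, norm_smul, ← Finset.mul_sum] at h1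
    rw [norm_inv, Complex.norm_real, Real.norm_of_nonneg hd0, le_inv_mul_iff₀ hd'] at h1
    obtain ⟨j, -, hj⟩ : ∃ j ∈ (Finset.univ : Finset ι),
        d * c / k ≤ ‖π.toAlgHom (ofFlip (σ j)) ζ - ζ‖ := by
      refine Finset.exists_le_of_sum_le Finset.univ_nonempty (le_of_eq_of_le ?_ h1)
      rw [Finset.sum_const, Finset.card_univ, nsmul_eq_mul, ← hkdef]
      field_simp
    have hnorm : ∀ z : B, ‖((‖ζ‖ : ℂ)⁻¹) • z‖ = ‖z‖ / ‖ζ‖ := fun z => by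
      rw [norm_smul, norm_inv, Complex.norm_real, norm_norm, inv_mul_eq_div]
    have h2 := h B hB (((‖ζ‖ : ℂ)⁻¹) • ζ) (((‖ζ‖ : ℂ)⁻¹) • π.toAlgHom (ofFlip (σ j)) ζ)
      (by rw [hnorm, div_self hζ0.ne'])
      (by rw [hnorm, norm_ofFlip_apply, div_self hζ0.ne'])
      (by
        rw [← smul_sub, hnorm, norm_sub_rev, div_le_div_iff₀ (by positivity) hζ0]
        rw [div_le_iff₀ hk0] at hj
        nlinarith)
    rw [← smul_add, hnorm, le_sub_comm, div_div, div_le_iff₀ (by positivity)] at h2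
    -- Only the flip `j` saves `2 * min δ 1 * ‖ζ‖`; all others get the triangle inequality. Division
    -- by `2 * k` yields the factor `l`.
    have h3 : ∑ i, ‖ζ + π.toAlgHom (ofFlip (σ i)) ζ‖ ≤
        ∑ i, (2 * ‖ζ‖ - if i = j then 2 * min δ 1 * ‖ζ‖ else 0) := by
      refine Finset.sum_le_sum fun i _ => ?_
      split_ifs with hi
      · have := min_le_left δ 1
        subst hi
        nlinarith
      · refine (norm_add_le _ _).trans ?_
        rw [norm_ofFlip_apply]
        linarith
    rw [Finset.sum_sub_distrib, Finset.sum_const, Finset.card_univ, nsmul_eq_mul, ← hkdef,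
      Finset.sum_ite_eq' Finset.univ j, if_pos (Finset.mem_univ j)] at h3
    refine (norm_markov_apply_le σ π ζ).trans ?_
    rw [← hkdef, inv_mul_le_iff₀ (by positivity), hl]
    refine h3.trans (le_of_eq ?_)
    field_simp
  refine le_of_forall_pos_le_add fun ε hε => ?_
  obtain ⟨ζ, hζ, hn⟩ := Submodule.Quotient.norm_mk_lt
    (Submodule.Quotient.mk ξ : B ⧸ π.invariants) (lt_min hε hd')
  rw [← hd] at hn
  have h1 := min_le_left ε d
  have h2 := min_le_right ε d
  have h3 := (hrep ζ hζ).trans (hclaim ζ hζ (by linarith))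
  have hl0 : 0 ≤ l := by rw [hl]; linarith
  have hl1 : l ≤ 1 := by rw [hl]; linarith
  nlinarith

end Markov

/-! ### From the spectral gap to the projection -/

section MaxRoe

open Roe RoeRep

variable {X : Type u} [EMetricSpace X] [BoundedGeometry X] {𝔅 : Set BanachSp.{v}}

lemma UniformlyConvexFamily.uniformConvexSpace (h : UniformlyConvexFamily 𝔅) {B : BanachSp.{v}}
    (hB : B ∈ 𝔅) : UniformConvexSpace B where
  uniform_convex ε hε := by
    obtain ⟨δ, hδ, hconv⟩ := h ε hε
    refine ⟨2 * δ, by positivity, fun x hx y hy hxy => ?_⟩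
    linarith [hconv B hB x y hx hy hxy]

/-- Nonnegativity of `C` covers the case of no representations, where the supremum is `0`. -/
lemma norm_normedRoe_le {T : NormedRoe X 𝔅} {C : ℝ} (hC : 0 ≤ C)
    (h : ∀ B ∈ 𝔅, ∀ π : RoeRep X B, ‖π.toNormedHom 𝔅 T‖ ≤ C) : ‖T‖ ≤ C :=
  Real.iSup_le (fun i => h _ i.1.2 i.2) hC

lemma RoeRep.extend_coe {B : BanachSp.{v}} (hB : B ∈ 𝔅) (π : RoeRep X B) (T : NormedRoe X 𝔅) :
    π.extend hB (T : MaxRoe X 𝔅) = π.toNormedHom 𝔅 T :=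
  UniformSpace.Completion.extensionHom_coe _ _ T

lemma RoeRep.continuous_extend {B : BanachSp.{v}} (hB : B ∈ 𝔅) (π : RoeRep X B) :
    Continuous (π.extend hB) :=
  UniformSpace.Completion.continuous_extension

lemma RoeRep.norm_extend_le {B : BanachSp.{v}} (hB : B ∈ 𝔅) (π : RoeRep X B) (p : MaxRoe X 𝔅) :
    ‖π.extend hB p‖ ≤ ‖p‖ := by
  induction p using UniformSpace.Completion.induction_on with
  | hp => exact isClosed_le (π.continuous_extend hB).norm continuous_norm
  | ih T =>
    rw [π.extend_coe hB, UniformSpace.Completion.norm_coe]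
    exact π.norm_toNormedHom_le hB T

/-- If the Markov operator contracts the distance to the invariant vectors, then the limit of its
powers is the projection onto the invariant vectors along the annihilator of the invariant
functionals. -/
theorem isIdempotentOntoAlong_of_tendsto {B : Type v} [NormedAddCommGroup B] [NormedSpace ℂ B]
    [UniformConvexSpace B] (π : RoeRep X B)
    {E : Set (X × X)} (hE : IsSymmGenerating E) {ι : Type*} [Fintype ι] [Nonempty ι]
    {σ : ι → Flip X} (hσ : ∀ x y, (x, y) ∈ E → ∃ i, σ i x = y) {l : ℝ} (hl1 : l < 1)
    (hl : ∀ ξ : B, ‖(Submodule.Quotient.mk (π.toAlgHom (markov σ) ξ) : B ⧸ π.invariants)‖ ≤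
        l * ‖(Submodule.Quotient.mk ξ : B ⧸ π.invariants)‖) {P : B →L[ℂ] B}
    (hlim : Tendsto (fun n => π.toAlgHom (markov σ) ^ n) atTop (𝓝 P)) :
    IsIdempotentOntoAlong P π.invariants π.annihilator := by
  set A := π.toAlgHom (markov σ) with hA
  have hfix : ∀ ξ ∈ π.invariants, A ξ = ξ := fun ξ hξ =>
    markov_apply_of_fixed π ((π.mem_invariants_iff hE hσ).1 hξ)
  have hlim' : ∀ ξ, Tendsto (fun n => (A ^ n) ξ) atTop (𝓝 (P ξ)) := fun ξ =>
    ((ContinuousLinearMap.apply ℂ B ξ).continuous.tendsto P).comp hlim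
  have hAP : A * P = P :=
    tendsto_nhds_unique (hlim.const_mul A)
      ((hlim.comp (tendsto_add_atTop_nat 1)).congr fun n => pow_succ' A n)
  have hPA : P * A = P :=
    tendsto_nhds_unique (hlim.mul_const A)
      ((hlim.comp (tendsto_add_atTop_nat 1)).congr fun n => pow_succ A n)
  have hPinv : ∀ ξ, P ξ ∈ π.invariants := by
    intro ξ
    have h1 : A (P ξ) = P ξ := DFunLike.congr_fun hAP ξ
    have h2 := hl (P ξ)
    rw [h1] at h2
    -- `A` fixes `P ξ` and contracts its quotient norm by `l < 1`. Each flip moves a vector by at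
    -- most twice that norm, so it fixes `P ξ`.
    have h3 : ‖(Submodule.Quotient.mk (P ξ) : B ⧸ π.invariants)‖ = 0 := by
      have := norm_nonneg (Submodule.Quotient.mk (P ξ) : B ⧸ π.invariants)
      nlinarith
    refine (π.mem_invariants_iff hE hσ).2 fun i => ?_
    have h4 := π.norm_sub_le_two_mul_norm_mk
      ((π.contractive _).trans (ellOneNorm_ofFlip_le (σ i)))
      (fun ζ hζ => (π.mem_invariants_iff hE hσ).1 hζ i) (P ξ)
    rw [h3, mul_zero] at h4
    exact sub_eq_zero.1 (norm_le_zero_iff.1 h4)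
  have hPfix : ∀ ξ ∈ π.invariants, P ξ = ξ := by
    intro ξ hξ
    refine tendsto_nhds_unique (hlim' ξ) (tendsto_const_nhds.congr fun n => ?_)
    induction n with
    | zero => simp
    | succ n ih => rw [pow_succ, mul_apply_eq_comp, hfix ξ hξ, ← ih]
  refine ⟨?_, ?_, ?_⟩
  · ext ξ
    exact hPfix _ (hPinv ξ)
  · ext ξ
    refine ⟨?_, fun hξ => ⟨ξ, hPfix ξ hξ⟩⟩
    rintro ⟨ζ, rfl⟩
    exact hPinv ζ
  · ext ξ
    rw [LinearMap.mem_ker, ContinuousLinearMap.coe_coe]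
    constructor
    -- An invariant functional is unchanged by `A`, hence by `P` in the limit, so it vanishes on
    -- `ker P`.
    · intro h f hf
      have hf' := (π.mem_dualInvariants_iff hE hσ).1 hf
      have hfA : ∀ ζ, f (A ζ) = f ζ := fun ζ => by
        have hk : (Fintype.card ι : ℂ) ≠ 0 := by simp
        simp only [hA, markov_apply, map_smul, map_sum, map_add, hf', Finset.sum_const,
          Finset.card_univ, nsmul_eq_mul, smul_eq_mul]
        field_simp
        ring
      have hfn : ∀ n : ℕ, f ((A ^ n) ξ) = f ξ := fun n => by
        induction n with
        | zero => simp
        | succ n ih => rw [pow_succ', mul_apply_eq_comp, hfA, ih]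
      have h1 := (f.continuous.tendsto (P ξ)).comp (hlim' ξ)
      rw [h, map_zero] at h1
      exact (tendsto_nhds_unique h1 (tendsto_const_nhds.congr fun n => (hfn n).symm)).symm
    · intro hξ
      refine SeparatingDual.eq_zero_of_forall_dual_eq_zero (R := ℂ) fun f => ?_
      refine hξ (f.comp P) ((π.mem_dualInvariants_iff hE hσ).2 fun i ζ => ?_)
      -- `P * A = P` makes `f ∘ P` equal to its lazy average; removing the identity half leaves
      -- harmonicity for the flips.
      refine invariant_of_harmonic (fun i => π.flipEquiv (σ i)) (f.comp P) (fun y => ?_) i ζ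
      have h1 : P (A y) = P y := DFunLike.congr_fun hPA y
      have h2 := congrArg f h1
      simp only [hA, markov_apply, map_smul, map_sum, map_add, Finset.sum_add_distrib,
        Finset.sum_const, Finset.card_univ, map_nsmul, nsmul_eq_mul, smul_eq_mul] at h2
      rw [inv_mul_eq_iff_eq_mul₀ (by simp)] at h2
      simp only [ContinuousLinearMap.comp_apply, flipEquiv_apply]
      linear_combination h2

/-- The powers `a ^ (n + n) = a ^ n * a ^ n` tend both to `p` and to `p * p`. -/
lemma isIdempotentElem_of_tendsto_pow {M : Type*} [Monoid M] [TopologicalSpace M] [T2Space M]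
    [ContinuousMul M] {a p : M} (h : Tendsto (fun n : ℕ => a ^ n) atTop (𝓝 p)) :
    IsIdempotentElem p :=
  tendsto_nhds_unique (h.mul h) ((h.comp
    (tendsto_id.atTop_add_atTop tendsto_id : Tendsto (fun n : ℕ => n + n) atTop atTop)).congr
      fun n => pow_add a n n)

lemma tendsto_extend_pow {B : BanachSp.{v}} (hB : B ∈ 𝔅) (π : RoeRep X B) {T : NormedRoe X 𝔅}
    {p : MaxRoe X 𝔅} (hp : Tendsto (fun n : ℕ => (T : MaxRoe X 𝔅) ^ n) atTop (𝓝 p)) :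
    Tendsto (fun n : ℕ => π.toNormedHom 𝔅 T ^ n) atTop (𝓝 (π.extend hB p)) :=
  (((π.continuous_extend hB).tendsto p).comp hp).congr fun n => by
    rw [Function.comp_apply, map_pow, π.extend_coe hB]

/-- If the Markov operator contracts the distance to the invariant vectors uniformly, then its
powers converge in `C_{𝔅,max}(X)`. -/
lemma exists_tendsto_markov_pow {E : Set (X × X)} (hE : IsSymmGenerating E) {ι : Type*} [Fintype ι]
    [Nonempty ι] {σ : ι → Flip X} (hσ : ∀ x y, (x, y) ∈ E → ∃ i, σ i x = y) {l : ℝ} (hl0 : 0 ≤ l)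
    (hl1 : l < 1) (hl : ∀ B ∈ 𝔅, ∀ π : RoeRep X B, ∀ ξ : B,
      ‖(Submodule.Quotient.mk (π.toAlgHom (markov σ) ξ) : B ⧸ π.invariants)‖ ≤
        l * ‖(Submodule.Quotient.mk ξ : B ⧸ π.invariants)‖)
    {a : NormedRoe X 𝔅} (ha : ∀ (B : BanachSp.{v}) (π : RoeRep X B),
      π.toNormedHom 𝔅 a = π.toAlgHom (markov σ)) :
    ∃ p : MaxRoe X 𝔅, Tendsto (fun n : ℕ => (a : MaxRoe X 𝔅) ^ n) atTop (𝓝 p) := by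
  have hpow : ∀ B ∈ 𝔅, ∀ (π : RoeRep X B) (n : ℕ) (ξ : B),
      ‖(Submodule.Quotient.mk ((π.toAlgHom (markov σ) ^ n) ξ) : B ⧸ π.invariants)‖ ≤
        l ^ n * ‖(Submodule.Quotient.mk ξ : B ⧸ π.invariants)‖ := by
    intro B hB π n ξ
    induction n with
    | zero => simp
    | succ n ih =>
      rw [pow_succ' (π.toAlgHom (markov σ)), mul_apply_eq_comp]
      refine (hl B hB π _).trans ?_
      rw [pow_succ' l, mul_assoc]
      exact mul_le_mul_of_nonneg_left ih hl0
  -- `A - 1` is applied to `A ^ n ξ`, whose quotient norm is at most `l ^ n * ‖ξ‖` in every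
  -- representation.
  have hdist : ∀ n, dist (a ^ n : NormedRoe X 𝔅) (a ^ (n + 1)) ≤ 2 * l ^ n := by
    intro n
    rw [dist_comm, dist_eq_norm]
    refine norm_normedRoe_le (by positivity) fun B hB π => ?_
    rw [map_sub, map_pow, map_pow, ha]
    refine ContinuousLinearMap.opNorm_le_bound _ (by positivity) fun ξ => ?_
    rw [sub_apply, pow_succ' (π.toAlgHom (markov σ)), mul_apply_eq_comp]
    have h1 := π.norm_sub_le_two_mul_norm_mk (norm_markov_le_one σ π)
      (fun ξ hξ => markov_apply_of_fixed π ((π.mem_invariants_iff hE hσ).1 hξ))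
      ((π.toAlgHom (markov σ) ^ n) ξ)
    have h2 := hpow B hB π n ξ
    have h3 : l ^ n * ‖(Submodule.Quotient.mk ξ : B ⧸ π.invariants)‖ ≤ l ^ n * ‖ξ‖ :=
      mul_le_mul_of_nonneg_left (Submodule.Quotient.norm_mk_le _ ξ) (by positivity)
    linarith
  have hdist' : ∀ n : ℕ, dist ((a : MaxRoe X 𝔅) ^ n) ((a : MaxRoe X 𝔅) ^ (n + 1)) ≤ 2 * l ^ n := by
    intro n
    have hcoe : ∀ n : ℕ, (a : MaxRoe X 𝔅) ^ n = ((a ^ n : NormedRoe X 𝔅) : MaxRoe X 𝔅) :=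
      fun n => (map_pow (UniformSpace.Completion.coeRingHom (α := NormedRoe X 𝔅)) a n).symm
    rw [hcoe, hcoe, UniformSpace.Completion.dist_eq]
    exact hdist n
  exact cauchySeq_tendsto_of_complete (cauchySeq_of_le_geometric l 2 hl1 hdist')

end MaxRoe

/-! ### Ultraproducts of representations -/

section Ultraproduct

open Roe RoeRep

variable {X : Type u} [EMetricSpace X] [BoundedGeometry X] {B : ℕ → BanachSp.{v}}
  (π : ∀ n, RoeRep X (B n)) (ω : Ultrafilter ℕ)

/-- The coordinatewise action on bounded sequences. -/
def seqAct (T : Roe X) :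
    lp (fun n => (B n : Type v)) ∞ →ₗ[ℂ] lp (fun n => (B n : Type v)) ∞ where
  toFun ξ := ⟨fun n => (π n).toAlgHom T (ξ n), memℓp_infty ⟨T.ellOneNorm * ‖ξ‖, by
    rintro _ ⟨n, rfl⟩
    exact ((π n).toAlgHom T).le_of_opNorm_le_of_le ((π n).contractive T)
      (lp.norm_apply_le_norm ENNReal.top_ne_zero ξ n)⟩⟩
  map_add' ξ η := by
    ext n
    exact map_add ((π n).toAlgHom T) _ _
  map_smul' c ξ := by
    ext n
    exact map_smul ((π n).toAlgHom T) _ _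

lemma seqAct_apply (T : Roe X) (ξ : lp (fun n => (B n : Type v)) ∞) (n : ℕ) :
    seqAct π T ξ n = (π n).toAlgHom T (ξ n) := rfl

lemma ellOneNorm_nonneg (T : Roe X) : 0 ≤ T.ellOneNorm := by
  refine Real.sInf_nonneg ?_
  rintro _ ⟨n, f, V, -, -, rfl⟩
  exact Finset.sum_nonneg fun _ _ => norm_nonneg _

/-- The `ℓ¹`-norm bounds all coordinates by one constant, so contractivity survives in the
ultraproduct. -/
lemma norm_seqAct_le (T : Roe X) (ξ : lp (fun n => (B n : Type v)) ∞) :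
    ‖seqAct π T ξ‖ ≤ T.ellOneNorm * ‖ξ‖ :=
  lp.norm_le_of_forall_le (mul_nonneg (ellOneNorm_nonneg T) (norm_nonneg _)) fun n =>
    ((π n).toAlgHom T).le_of_opNorm_le_of_le ((π n).contractive T)
      (lp.norm_apply_le_norm ENNReal.top_ne_zero ξ n)

/-- The action on the ultraproduct. -/
def ultraAct (T : Roe X) : Ultraproduct B ω →ₗ[ℂ] Ultraproduct B ω :=
  (ultraNull B ω).mapQ (ultraNull B ω) (seqAct π T) fun ξ hξ => by
    have h : Tendsto (fun n => T.ellOneNorm * ‖ξ n‖) ω (𝓝 0) := by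
      simpa using Tendsto.const_mul T.ellOneNorm (show Tendsto (fun n => ‖ξ n‖) ω (𝓝 0) from hξ)
    exact squeeze_zero (fun n => norm_nonneg _)
      (fun n => ((π n).toAlgHom T).le_of_opNorm_le ((π n).contractive T) (ξ n)) h

lemma ultraAct_mk (T : Roe X) (ξ : lp (fun n => (B n : Type v)) ∞) :
    ultraAct π ω T (Submodule.Quotient.mk ξ) = Submodule.Quotient.mk (seqAct π T ξ) := rfl

lemma norm_ultraAct_le (T : Roe X) (x : Ultraproduct B ω) :
    ‖ultraAct π ω T x‖ ≤ T.ellOneNorm * ‖x‖ := by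
  have hT := ellOneNorm_nonneg T
  refine le_of_forall_pos_le_add fun ε hε => ?_
  obtain ⟨ξ, rfl, hn⟩ := Submodule.Quotient.norm_mk_lt x
    (show 0 < ε / (T.ellOneNorm + 1) by positivity)
  rw [ultraAct_mk]
  refine (Submodule.Quotient.norm_mk_le _ _).trans ((norm_seqAct_le π T ξ).trans ?_)
  refine (mul_le_mul_of_nonneg_left hn.le hT).trans ?_
  rw [mul_add]
  gcongr
  rw [mul_div_assoc', div_le_iff₀ (by positivity)]
  nlinarith

lemma ultraAct_one (x : Ultraproduct B ω) : ultraAct π ω 1 x = x := by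
  obtain ⟨ξ, rfl⟩ := Submodule.Quotient.mk_surjective _ x
  rw [ultraAct_mk]
  congr 1
  ext n
  rw [seqAct_apply, map_one, one_apply_eq_self]

lemma ultraAct_mul (T S : Roe X) (x : Ultraproduct B ω) :
    ultraAct π ω (T * S) x = ultraAct π ω T (ultraAct π ω S x) := by
  obtain ⟨ξ, rfl⟩ := Submodule.Quotient.mk_surjective _ x
  rw [ultraAct_mk, ultraAct_mk, ultraAct_mk]
  congr 1
  ext n
  rw [seqAct_apply, seqAct_apply, seqAct_apply, map_mul, mul_apply_eq_comp]

lemma ultraAct_zero (x : Ultraproduct B ω) : ultraAct π ω 0 x = 0 := by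
  obtain ⟨ξ, rfl⟩ := Submodule.Quotient.mk_surjective _ x
  rw [ultraAct_mk, ← Submodule.Quotient.mk_zero]
  congr 1
  ext n
  rw [seqAct_apply, map_zero]
  rfl

lemma ultraAct_add (T S : Roe X) (x : Ultraproduct B ω) :
    ultraAct π ω (T + S) x = ultraAct π ω T x + ultraAct π ω S x := by
  obtain ⟨ξ, rfl⟩ := Submodule.Quotient.mk_surjective _ x
  rw [ultraAct_mk, ultraAct_mk, ultraAct_mk, ← Submodule.Quotient.mk_add]
  congr 1
  ext n
  rw [seqAct_apply, map_add]
  rfl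

lemma ultraAct_algebraMap (c : ℂ) (x : Ultraproduct B ω) :
    ultraAct π ω (algebraMap ℂ (Roe X) c) x = c • x := by
  obtain ⟨ξ, rfl⟩ := Submodule.Quotient.mk_surjective _ x
  rw [ultraAct_mk, ← Submodule.Quotient.mk_smul]
  congr 1
  ext n
  rw [seqAct_apply, AlgHom.commutes]
  rfl

variable {ω} {B' : BanachSp.{v}} (e : B' ≃ₗᵢ[ℂ] Ultraproduct B ω)

/-- The action on a Banach space isometric to the ultraproduct. -/
def ultraOp (T : Roe X) : B' →L[ℂ] B' :=
  LinearMap.mkContinuous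
    (e.symm.toLinearEquiv.toLinearMap ∘ₗ ultraAct π ω T ∘ₗ e.toLinearEquiv.toLinearMap)
    T.ellOneNorm fun x => by
      have := norm_ultraAct_le π ω T (e x)
      rw [e.norm_map] at this
      exact (e.symm.norm_map _).trans_le this

lemma ultraOp_apply (T : Roe X) (x : B') : ultraOp π e T x = e.symm (ultraAct π ω T (e x)) := rfl

lemma norm_ultraOp_le (T : Roe X) : ‖ultraOp π e T‖ ≤ T.ellOneNorm :=
  LinearMap.mkContinuous_norm_le _ (ellOneNorm_nonneg T) _

/-- The ultraproduct of representations, on a Banach space isometric to the ultraproduct. -/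
def ultraRep : RoeRep X B' where
  toAlgHom :=
    { toFun := ultraOp π e
      map_one' := by
        ext x
        rw [ultraOp_apply, ultraAct_one, e.symm_apply_apply, one_apply_eq_self]
      map_mul' := fun T S => by
        ext x
        rw [ultraOp_apply, ultraAct_mul, mul_apply_eq_comp, ultraOp_apply, ultraOp_apply,
          e.apply_symm_apply]
      map_zero' := by
        ext x
        rw [ultraOp_apply, ultraAct_zero, map_zero, zero_apply]
      map_add' := fun T S => by
        ext x
        rw [ultraOp_apply, ultraAct_add, map_add, add_apply, ultraOp_apply, ultraOp_apply]
      commutes' := fun c => by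
        ext x
        rw [ultraOp_apply, ultraAct_algebraMap, map_smul, e.symm_apply_apply]
        rfl }
  contractive := norm_ultraOp_le π e

lemma ultraRep_apply (T : Roe X) (x : B') :
    (ultraRep π e).toAlgHom T x = e.symm (ultraAct π ω T (e x)) := rfl

end Ultraproduct

/-! ### From the projection to the spectral gap -/

section Converse

open Roe RoeRep

variable {X : Type u} [EMetricSpace X] [BoundedGeometry X]

lemma IsIdempotentOntoAlong.apply_mem {B : Type v} [NormedAddCommGroup B] [NormedSpace ℂ B]
    {P : B →L[ℂ] B} {M N : Submodule ℂ B} (h : IsIdempotentOntoAlong P M N) (ξ : B) : P ξ ∈ M :=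
  h.range_eq ▸ LinearMap.mem_range_self (P : B →ₗ[ℂ] B) ξ

lemma IsIdempotentOntoAlong.apply_of_mem {B : Type v} [NormedAddCommGroup B] [NormedSpace ℂ B]
    {P : B →L[ℂ] B} {M N : Submodule ℂ B} (h : IsIdempotentOntoAlong P M N) {ξ : B} (hξ : ξ ∈ M) :
    P ξ = ξ := by
  rw [← h.range_eq] at hξ
  obtain ⟨ζ, rfl⟩ := hξ
  exact DFunLike.congr_fun h.idem ζ

lemma IsIdempotentOntoAlong.apply_eq_zero {B : Type v} [NormedAddCommGroup B] [NormedSpace ℂ B]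
    {P : B →L[ℂ] B} {M N : Submodule ℂ B} (h : IsIdempotentOntoAlong P M N) {ξ : B} (hξ : ξ ∈ N) :
    P ξ = 0 := by
  rw [← h.ker_eq] at hξ
  exact hξ

/-- Without a spectral gap there are almost invariant vectors in the kernel of the projection onto
the invariant vectors. -/
lemma exists_almost_invariant {B : Type v} [NormedAddCommGroup B] [NormedSpace ℂ B]
    (π : RoeRep X B) {E : Set (X × X)} (hE : IsSymmGenerating E) {ι : Type*} [Fintype ι]
    [Nonempty ι] {σ : ι → Flip X} (hσ : ∀ x y, (x, y) ∈ E → ∃ i, σ i x = y)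
    (hσE : ∀ i x, σ i x ≠ x → (x, σ i x) ∈ E) {P : B →L[ℂ] B}
    (hP : IsIdempotentOntoAlong P π.invariants π.annihilator) {C : ℝ} (hC : ‖P‖ ≤ C) {c : ℝ}
    (hgap : ¬ π.HasSpectralGap E c) :
    ∃ η : B, 1 ≤ ‖η‖ ∧ ‖η‖ ≤ (1 + C) * 2 ∧ P η = 0 ∧
      ∀ i, ‖π.toAlgHom (ofFlip (σ i)) η - η‖ ≤ (1 + C) * c := by
  have hsub : ∀ ζ : B, ‖ζ - P ζ‖ ≤ (1 + C) * ‖ζ‖ := fun ζ => by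
    have h1 := P.le_of_opNorm_le hC ζ
    have h2 := norm_sub_le ζ (P ζ)
    linarith
  unfold HasSpectralGap at hgap
  push Not at hgap
  obtain ⟨ξ₀, hξ₀, hV₀⟩ := hgap
  obtain ⟨ξ, hξ, hn⟩ := Submodule.Quotient.norm_mk_lt
    (Submodule.Quotient.mk ξ₀ : B ⧸ π.invariants) one_pos
  rw [hξ₀] at hn
  have hC0 : 0 ≤ C := (norm_nonneg P).trans hC
  set η : B := ξ - P ξ with hη
  have hPη : P η = 0 := by rw [hη, map_sub, hP.apply_of_mem (hP.apply_mem ξ), sub_self]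
  have hmk : (Submodule.Quotient.mk η : B ⧸ π.invariants) = Submodule.Quotient.mk ξ₀ := by
    rw [← hξ, Submodule.Quotient.eq, hη, sub_sub_cancel_left]
    exact neg_mem (hP.apply_mem ξ)
  refine ⟨η, ?_, ?_, hPη, fun i => ?_⟩
  · rw [← hξ₀, ← hmk]
    exact Submodule.Quotient.norm_mk_le _ η
  · refine (hsub ξ).trans (mul_le_mul_of_nonneg_left ?_ (by positivity))
    linarith
  -- The flip has diagonal entries at its fixed points, which may lie outside `E`. Its moving part
  -- is supported in `E` and displaces vectors equally.
  · obtain ⟨V, hV, hVσ, hVeq⟩ := exists_isPartialTranslation_sub_eq (σ i)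
    have hsupp : V.supp ⊆ E := fun p hp => by
      obtain ⟨h1, h2⟩ := hVσ _ _ hp
      have := hσE i _ h2
      rwa [h1] at this
    have happ : ∀ ζ : B, π.toAlgHom V ζ - π.toAlgHom (diag V.rowSum) ζ =
        π.toAlgHom (ofFlip (σ i)) ζ - ζ := fun ζ => by
      have := DFunLike.congr_fun (congrArg π.toAlgHom hVeq) ζ
      rwa [map_sub, map_sub, map_one, sub_apply, sub_apply, one_apply_eq_self] at this
    have hlt := hV₀ V hV hsupp
    have hinv : π.toAlgHom (ofFlip (σ i)) (ξ₀ - η) = ξ₀ - η :=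
      (π.mem_invariants_iff hE hσ).1 ((Submodule.Quotient.eq _).1 hmk.symm) i
    have heq : π.toAlgHom (ofFlip (σ i)) ξ₀ - ξ₀ = π.toAlgHom (ofFlip (σ i)) η - η := by
      rwa [map_sub, sub_eq_sub_iff_sub_eq_sub] at hinv
    rw [happ, heq] at hlt
    set θ := π.toAlgHom (ofFlip (σ i)) η - η with hθ
    -- Invariant functionals kill the displacement `θ`, so `θ = ζ - P ζ` for every representative
    -- `ζ` of its class. Smallness in the quotient thus becomes smallness in norm, at the cost of `1
    -- + C`.
    have hPθ : P θ = 0 := hP.apply_eq_zero fun f hf => by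
      rw [hθ, map_sub, (π.mem_dualInvariants_iff hE hσ).1 hf, sub_self]
    obtain ⟨ζ, hζ, hζn⟩ := Submodule.Quotient.norm_mk_lt
      (Submodule.Quotient.mk θ : B ⧸ π.invariants) (sub_pos.2 hlt)
    have h1 := hP.apply_of_mem ((Submodule.Quotient.eq _).1 hζ)
    rw [map_sub, hPθ, sub_zero] at h1
    have h2 : θ = ζ - P ζ := by rw [h1, sub_sub_cancel]
    rw [h2]
    refine (hsub ζ).trans (mul_le_mul_of_nonneg_left ?_ (by positivity))
    linarith

/-- If the projections onto the invariant vectors come from a single element of `C_{𝔅,max}(X)`, then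
all representations on members of `𝔅` have a common spectral gap. -/
theorem uniformGeometricT_of_projection {E : Set (X × X)} (hE : IsSymmGenerating E)
    {𝔅 : Set BanachSp.{v}} (hultra : ClosedUnderUltraproducts 𝔅) {p : MaxRoe X 𝔅}
    (hp : ∀ (B : BanachSp.{v}) (hB : B ∈ 𝔅) (π : RoeRep X B),
      IsIdempotentOntoAlong (π.extend hB p) π.invariants π.annihilator) :
    UniformGeometricT E 𝔅 := by
  obtain ⟨K, σ, hσ, hσE⟩ := exists_flips hE.isEntourage hE.symm
  by_contra hnot
  unfold UniformGeometricT at hnot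
  push Not at hnot
  choose B hB π hgap using fun n : ℕ => hnot (1 / ((n : ℝ) + 1)) (by positivity)
  choose η hη1 hη2 hη0 hησ using fun n => exists_almost_invariant (π n) hE hσ hσE
    (hp (B n) (hB n) (π n)) ((π n).norm_extend_le (hB n) p) (hgap n)
  set ω : Ultrafilter ℕ := hyperfilter ℕ with hω
  have hωle : (ω : Filter ℕ) ≤ atTop := Nat.hyperfilter_le_atTop
  obtain ⟨B', hB', ⟨e⟩⟩ := hultra B hB ω fun n hn => by
    have h1 : ({n}ᶜ : Set ℕ) ∈ ω := hωle ((Set.finite_singleton n).compl_mem_cofinite |>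
      fun h => Nat.cofinite_eq_atTop ▸ h)
    rw [hn] at h1
    exact h1 rfl
  let ξ : lp (fun n => (B n : Type v)) ∞ := ⟨η, memℓp_infty ⟨(1 + ‖p‖) * 2, by
    rintro _ ⟨n, rfl⟩
    exact hη2 n⟩⟩
  set v : B' := e.symm (Submodule.Quotient.mk ξ) with hv
  have hv0 : v ≠ 0 := by
    intro h
    rw [hv, e.symm.map_eq_zero_iff, Submodule.Quotient.mk_eq_zero] at h
    have h0 : Tendsto (fun n => ‖ξ n‖) ω (𝓝 0) := h
    exact absurd (ge_of_tendsto' h0 hη1) (by norm_num)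
  have hvinv : v ∈ (ultraRep π e).invariants := by
    refine ((ultraRep π e).mem_invariants_iff hE hσ).2 fun i => ?_
    rw [ultraRep_apply, hv, e.apply_symm_apply, ultraAct_mk]
    congr 1
    rw [Submodule.Quotient.eq]
    have h0 : Tendsto (fun n : ℕ => (1 + ‖p‖) * (1 / ((n : ℝ) + 1))) ω (𝓝 0) := by
      simpa using (tendsto_one_div_add_atTop_nhds_zero_nat.const_mul (1 + ‖p‖)).mono_left hωle
    exact squeeze_zero (fun n => norm_nonneg _) (fun n => hησ n i) h0
  set Q := (ultraRep π e).extend hB' with hQ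
  have hQv : Q p v = v := (hp B' hB' (ultraRep π e)).apply_of_mem hvinv
  have hv0' : 0 < ‖v‖ := norm_pos_iff.2 hv0
  set D : ℝ := ‖v‖ + (1 + ‖p‖) * 2 with hD
  have hD0 : 0 < D := by positivity
  -- Split `v = Q p v` as `Q (p - T) v + Q T v`. In the second term `T` acts on `η n` as `T - p`,
  -- since `p` kills `η n`. By density of `ℂ_u[X]` the right-hand side can be made smaller than
  -- `‖v‖`.
  have hbound : ∀ T : NormedRoe X 𝔅, ‖v‖ ≤ ‖p - (T : MaxRoe X 𝔅)‖ * D := by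
    intro T
    have h1 : ‖Q (p - T) v‖ ≤ ‖p - (T : MaxRoe X 𝔅)‖ * ‖v‖ :=
      (Q (p - T)).le_of_opNorm_le ((ultraRep π e).norm_extend_le hB' _) v
    have h2 : ‖Q T v‖ ≤ ‖p - (T : MaxRoe X 𝔅)‖ * ((1 + ‖p‖) * 2) := by
      have h3 : Q T v = e.symm (Submodule.Quotient.mk (seqAct π T ξ)) := by
        rw [hQ, (ultraRep π e).extend_coe hB']
        refine (ultraRep_apply π e T v).trans ?_
        rw [hv, e.apply_symm_apply]
        rfl
      rw [h3, e.symm.norm_map]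
      refine (Submodule.Quotient.norm_mk_le _ _).trans
        (lp.norm_le_of_forall_le (by positivity) fun n => ?_)
      have h4 : seqAct π T ξ n = (π n).extend (hB n) (T - p) (η n) := by
        rw [map_sub, sub_apply, hη0 n, sub_zero, (π n).extend_coe (hB n)]
        rfl
      rw [h4, norm_sub_rev]
      exact ContinuousLinearMap.le_of_opNorm_le_of_le _ ((π n).norm_extend_le (hB n) _) (hη2 n)
    calc ‖v‖ = ‖Q (p - T) v + Q T v‖ := by
          rw [map_sub, sub_apply, sub_add_cancel, hQv]
      _ ≤ _ := (norm_add_le _ _).trans (by rw [hD, mul_add]; exact add_le_add h1 h2)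
  obtain ⟨T, hT⟩ := (UniformSpace.Completion.denseRange_coe (α := NormedRoe X 𝔅)).exists_dist_lt p
    (show 0 < ‖v‖ / D by positivity)
  rw [dist_eq_norm, lt_div_iff₀ hD0] at hT
  exact absurd (hbound T) (not_le.2 hT)

end Converse

end GeomBanachT

end

/-! ### The equivalence -/

open GeomBanachT
theorem theorem4p6 {X : Type u} [EMetricSpace X] [BoundedGeometry X]
    (hX : IsSeparatedUnionOfFinite X) (E₀ : Set (X × X)) (hE₀ : IsSymmGenerating E₀)
    (𝔅 : Set BanachSp.{v}) (hconv : UniformlyConvexFamily 𝔅)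
    (hultra : ClosedUnderUltraproducts 𝔅) :
    UniformGeometricT E₀ 𝔅 ↔
      ∃ p : MaxRoe X 𝔅, IsIdempotentElem p ∧
        ∀ (B : BanachSp.{v}) (hB : B ∈ 𝔅) (π : RoeRep X B),
          IsIdempotentOntoAlong (π.extend hB p) π.invariants π.annihilator := by
  refine ⟨fun ⟨c, hc, hgap⟩ => ?_, fun ⟨p, _, hp⟩ => uniformGeometricT_of_projection hE₀ hultra hp⟩
  obtain ⟨K, σ, hσ, -⟩ := exists_flips hE₀.isEntourage hE₀.symm
  obtain ⟨l, hl0, hl1, hl⟩ := exists_markov_contraction hE₀ hσ hconv hc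
  have hl' : ∀ B ∈ 𝔅, ∀ π : RoeRep X B, ∀ ξ : B,
      ‖(Submodule.Quotient.mk (π.toAlgHom (markov σ) ξ) : B ⧸ π.invariants)‖ ≤
        l * ‖(Submodule.Quotient.mk ξ : B ⧸ π.invariants)‖ :=
    fun B hB π => hl B hB π (hgap B hB π)
  -- The Markov element lies in `ℂ_u[X]`, so one limit in the completion serves all representations
  -- at once.
  obtain ⟨p, hp⟩ := exists_tendsto_markov_pow hE₀ hσ hl0 hl1 hl'
    (a := (markov σ : Roe X)) fun _ _ => rfl
  refine ⟨p, isIdempotentElem_of_tendsto_pow hp, fun B hB π => ?_⟩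
  have := hconv.uniformConvexSpace hB
  exact isIdempotentOntoAlong_of_tendsto π hE₀ hσ hl1 (hl' B hB π) (tendsto_extend_pow hB π hp)
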